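/- Let $T\ge 1$ and consider the regression model $Y_t=f_\star(X_t)+W_t$, $t=0,1,2,\dots$, on a probability space, with covariates $X_t$ in a set $\mathsf X\subset\mathbb R^{d_x}$ and $Y_t,W_t\in\mathbb R^{d_y}$. There is a filtration $\{\mathcal F_t\}_{t\ge -1}$ for which $\{W_t\}$ is a square-integrable martingale difference sequence and $X_t$ is $\mathcal F_{t-1}$-measurable. Let $\mathscr F$ be a class of measurable functions $\mathbb R^{d_x}\to\mathbb R^{d_y}$ with $f_\star\in\mathscr F$, and let $\mathscr F_\star=\{f-f_\star: f\in\mathscr F\}$. Write $\|f\|_\infty=\sup_{x\in\mathsf X}\|f(x)\|_2$ and $\|f\|_{L^2}^2=\frac1T\sum_{t=0}^{T-1}\mathbb E\|f(X_t)\|_2^2$ (for a random $f$, the expectation here is over an independent copy of the covariates). Let $$\widehat f\in\operatorname*{arg\,min}_{f\in\mathscr F}\frac1T\sum_{t=0}^{T-1}\|Y_t-f(X_t)\|_2^2$$ be a least-squares estimator whose excess risk $\|\widehat f-f_\star\|_{L^2}^2$ is measurable, and let $$\mathsf M_T(\mathscr F_\star)=\sup_{f\in\mathscr F_\star}\frac1T\sum_{t=0}^{T-1}\bigl(4\langle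 W_t,f(X_t)\rangle-\|f(X_t)\|_2^2\bigr)$$ be the martingale offset complexity. Let $\Gamma_{\mathsf{dep}}(\mathsf P_X)\in\mathbb R^{T\times T}$ be the dependency matrix of $X_0,\dots,X_{T-1}$: it is upper triangular with unit diagonal, and for $i<j$ its entry is $$\Gamma_{ij}=\sqrt{2\sup_A\|\mathsf P_{X_{j:T-1}}(\cdot\mid A)-\mathsf P_{X_{j:T-1}}\|_{\mathsf{TV}}},$$ where $A$ ranges over the events of positive probability in $\sigma(X_0,\dots,X_i)$ and $\|\mu-\nu\|_{\mathsf{TV}}=\sup_E|\mu(E)-\nu(E)|$. Let $\|\Gamma_{\mathsf{dep}}(\mathsf P_X)\|_{\mathsf{op}}$ be its largest singular value. Let $B\ge1$, $p\ge0$ and $q\in(0,2)$. Suppose that $\mathscr F_\star$ is star-shaped ($\alpha f\in\mathscr F_\star$ for all $f\in\mathscr F_\star$, $\alpha\in[0,1]$) and $B$-bounded ($\|f\|_\infty\le B$ for all $f\in\mathscr F_\star$), and that $\log\mathcal N_\infty(\mathscr F_\star,\varepsilon)\le p\,\varepsilon^{-q}$ for all $\varepsilon\in(0,1)$, where $\mathcal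 N_\infty(\mathscr F_\star,\varepsilon)$ is the size of a smallest $\varepsilon$-cover of $\mathscr F_\star$, with centres in $\mathscr F_\star$, in the norm $\|\cdot\|_\infty$. (No hypercontractivity is assumed beyond the trajectory $(B^2,1)$-hypercontractivity that $B$-boundedness implies.) Then $\|\widehat f-f_\star\|_{L^2}^2$ and $\mathsf M_T(\mathscr F_\star)$ are integrable and $$\mathbb E\|\widehat f-f_\star\|_{L^2}^2\le 8\,\mathbb E\,\mathsf M_T(\mathscr F_\star)+8\left(16B^2p\,\|\Gamma_{\mathsf{dep}}(\mathsf P_X)\|_{\mathsf{op}}^2\right)^{2/q}T^{-\frac{2}{2+q}}+\exp\left(\frac{-T^{q/(2+q)}}{16B^2\|\Gamma_{\mathsf{dep}}(\mathsf P_X)\|_{\mathsf{op}}^2}\right).$$ -/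

import Mathlib

open MeasureTheory ProbabilityTheory

noncomputable section

namespace LittleMixing

/-- `ℝ^d` with its Euclidean norm. -/
abbrev Euc (d : ℕ) : Type := EuclideanSpace ℝ (Fin d)

section FunctionClasses

variable {dx dy : ℕ}

/-- The shifted class `F - {fstar}`. -/
def shiftedClass (F : Set (Euc dx → Euc dy)) (fstar : Euc dx → Euc dy) :
    Set (Euc dx → Euc dy) :=
  {h | ∃ f ∈ F, h = f - fstar}

/-- `G` is star-shaped (around `0`): `a • f ∈ G` for all `f ∈ G` and `a ∈ [0,1]`. -/
def StarShaped (G : Set (Euc dx → Euc dy)) : Prop :=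
  ∀ f ∈ G, ∀ a : ℝ, 0 ≤ a → a ≤ 1 → a • f ∈ G

/-- The supremum norm over `D`, with values in `[0, ∞]`. -/
def supNorm (D : Set (Euc dx)) (f : Euc dx → Euc dy) : ENNReal :=
  ⨆ x ∈ D, ‖f x‖ₑ

/-- Every element of the class is bounded by `B` in the supremum norm over `D`. -/
def IsBoundedClass (D : Set (Euc dx)) (G : Set (Euc dx → Euc dy)) (B : ℝ) : Prop :=
  ∀ f ∈ G, supNorm D f ≤ ENNReal.ofReal B

/-- `N ⊆ G` is an `ε`-cover of `G` in the supremum norm over `D`. -/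
def IsSupCover (D : Set (Euc dx)) (G N : Set (Euc dx → Euc dy)) (ε : ℝ) : Prop :=
  N ⊆ G ∧ ∀ f ∈ G, ∃ g ∈ N, supNorm D (f - g) ≤ ENNReal.ofReal ε

/-- The size of a smallest `ε`-cover of `G` contained in `G` (`⊤` if no cover is finite). -/
def coveringNumber (D : Set (Euc dx)) (G : Set (Euc dx → Euc dy)) (ε : ℝ) : ℕ∞ :=
  ⨅ (N : Set (Euc dx → Euc dy)) (_ : IsSupCover D G N ε), N.encard

/-- For all `ε ∈ (0,1)` the covering number is finite and its logarithm is at most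
`p (1/ε)^q`. -/
def EntropyBound (D : Set (Euc dx)) (G : Set (Euc dx → Euc dy)) (p q : ℝ) : Prop :=
  ∀ ε : ℝ, 0 < ε → ε < 1 →
    coveringNumber D G ε ≠ ⊤ ∧
      Real.log ((coveringNumber D G ε).toNat : ℝ) ≤ p * (1 / ε) ^ q

end FunctionClasses

section Dependency

/-- Total variation `sup_A |μ A - ν A|` over measurable sets (for finite measures). -/
def tvDist {S : Type*} [MeasurableSpace S] (μ ν : Measure S) : ℝ :=
  ⨆ A : {A : Set S // MeasurableSet A}, |μ.real A - ν.real A|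

variable {Ω S : Type*} [MeasurableSpace Ω] [MeasurableSpace S]

/-- The σ-algebra generated by `Z 0, …, Z i`. -/
@[reducible] def pastSigma (Z : ℕ → Ω → S) (i : ℕ) : MeasurableSpace Ω :=
  ⨆ k ∈ Set.Iic i, MeasurableSpace.comap (Z k) inferInstance

/-- The segment `Z_{j:T-1} = (Z j, …, Z (T-1))`. -/
def segment (Z : ℕ → Ω → S) (j T : ℕ) (ω : Ω) : Set.Ico j T → S :=
  fun k => Z k ω

/-- `sup_A ‖P_{Z_{j:T-1}}(· | A) - P_{Z_{j:T-1}}‖_TV`, over the events `A` of positive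
probability in the σ-algebra generated by `Z 0, …, Z i`. -/
def mixingCoeff (P : Measure Ω) (Z : ℕ → Ω → S) (T i j : ℕ) : ℝ :=
  ⨆ A : {A : Set Ω // MeasurableSet[pastSigma Z i] A ∧ P A ≠ 0},
    tvDist ((ProbabilityTheory.cond P A).map (segment Z j T)) (P.map (segment Z j T))

/-- The dependency matrix of `Z 0, …, Z (T-1)`. -/
def dependencyMatrix (P : Measure Ω) (Z : ℕ → Ω → S) (T : ℕ) : Matrix (Fin T) (Fin T) ℝ :=
  Matrix.of fun i j =>
    if i < j then Real.sqrt (2 * mixingCoeff P Z T i j) else if i = j then 1 else 0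

/-- The largest singular value of a square real matrix, that is, its operator norm for the
Euclidean norm. -/
def matrixOpNorm {n : ℕ} (M : Matrix (Fin n) (Fin n) ℝ) : ℝ :=
  ‖Matrix.toEuclideanCLM (𝕜 := ℝ) M‖

end Dependency

section Regression

variable {Ω : Type*} [MeasurableSpace Ω] {dx dy : ℕ}

/-- The regression model `Y t = fstar (X t) + W t` on a probability space: the covariates take
values in `D`, and for the filtration `𝓕` (whose member `𝓕 t` collects the information available
before the noise `W t` is revealed, so that it carries the index `t - 1` in the usual numbering)
`X t` is `𝓕 t`-measurable and `W` is a square integrable martingale difference sequence. -/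
structure IsRegressionModel (P : Measure Ω) (𝓕 : Filtration ℕ (inferInstance : MeasurableSpace Ω))
    (D : Set (Euc dx)) (fstar : Euc dx → Euc dy)
    (X : ℕ → Ω → Euc dx) (W Y : ℕ → Ω → Euc dy) : Prop where
  mem_domain : ∀ t ω, X t ω ∈ D
  covariate_adapted : ∀ t, Measurable[𝓕 t] (X t)
  noise_adapted : ∀ t, Measurable[𝓕 (t + 1)] (W t)
  noise_memLp : ∀ t, MemLp (W t) 2 P
  noise_condExp : ∀ t, P[W t | 𝓕 t] =ᵐ[P] 0
  observation : ∀ t ω, Y t ω = fstar (X t ω) + W t ω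

/-- `‖f‖²_{L²(P_X)} = (1/T) ∑_{t<T} E ‖f (X t)‖²`. -/
def sqL2Norm (P : Measure Ω) (X : ℕ → Ω → Euc dx) (T : ℕ) (f : Euc dx → Euc dy) : ℝ :=
  (1 / (T : ℝ)) * ∑ t ∈ Finset.range T, ∫ ω, ‖f (X t ω)‖ ^ 2 ∂P

/-- The empirical square loss of `f` on the sample `(X t ω, Y t ω)`, `t < T`. -/
def empiricalLoss (X : ℕ → Ω → Euc dx) (Y : ℕ → Ω → Euc dy) (T : ℕ) (f : Euc dx → Euc dy)
    (ω : Ω) : ℝ :=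
  (1 / (T : ℝ)) * ∑ t ∈ Finset.range T, ‖Y t ω - f (X t ω)‖ ^ 2

/-- `fhat` is a least-squares estimator over `F`: almost surely it lies in `F` and minimizes the
empirical loss over `F`. -/
def IsLeastSquares (P : Measure Ω) (F : Set (Euc dx → Euc dy)) (X : ℕ → Ω → Euc dx)
    (Y : ℕ → Ω → Euc dy) (T : ℕ) (fhat : Ω → Euc dx → Euc dy) : Prop :=
  ∀ᵐ ω ∂P, fhat ω ∈ F ∧ ∀ f ∈ F, empiricalLoss X Y T (fhat ω) ω ≤ empiricalLoss X Y T f ω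

/-- The excess risk `‖fhat - fstar‖²_{L²(P_X)}`, a random variable through `fhat` only: the
expectation inside the norm is over a fresh copy of the covariates. -/
def excessRisk (P : Measure Ω) (X : ℕ → Ω → Euc dx) (T : ℕ) (fstar : Euc dx → Euc dy)
    (fhat : Ω → Euc dx → Euc dy) (ω : Ω) : ℝ :=
  sqL2Norm P X T (fhat ω - fstar)

/-- The martingale offset complexity of the class `G`, a random variable. -/
def offsetComplexity (X : ℕ → Ω → Euc dx) (W : ℕ → Ω → Euc dy) (T : ℕ)
    (G : Set (Euc dx → Euc dy)) (ω : Ω) : ℝ :=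
  ⨆ f : G, (1 / (T : ℝ)) * ∑ t ∈ Finset.range T,
    (4 * inner ℝ (W t ω) (f.1 (X t ω)) - ‖f.1 (X t ω)‖ ^ 2)

end Regression

end LittleMixing

end

noncomputable section

namespace LittleMixing

/-! ### Bounded functions, conditional expectations, quadratic transport. -/

section Bounded

variable {Ω : Type*} {m mΩ : MeasurableSpace Ω} {P : Measure Ω}

/-! The basic inequality of least squares bounds the empirical squared norm of `fhat - fstar` by the
offset complexity. To pass to the population norm one needs a lower isometry: off a rare event,
every member of the shifted class with squared population norm at least `ρ` has squared population
norm at most 8 times its empirical one. The risk is then at most `8 * offsetComplexity` in this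
regime, at most `ρ` below the critical radius, and at most `b ^ 2` on the rare event, for any
uniform bound `b` of the class (`integral_excessRisk_le_of_cover`).

The lower isometry (`exists_lower_isometry_event`) is a union bound over a finite cover, after
star-shapedness has scaled each function down to the sphere of squared radius `ρ`. For a single
function it is a lower-tail bound for a sum of nonnegative functions of dependent observations,
obtained by Chernoff's method from the Laplace bound `integral_exp_neg_sum_le`.

That Laplace bound is dual, through the Gibbs variational formula, to the transport inequality
`sum_integral_mul_one_sub_le`, in the spirit of Marton and Samson. Reveal the observations one by
one, and let `q k` be the density `D` conditioned on the first `k` of them. The entropy increments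
dominate one-sided quadratic distances `e k` between `q k` and `q (k + 1)`. Step `k` moves the law
of `Z j` by at most the square root of `2 * mixingCoeff P Z T k j * e k` if `k < j`, and of `e k` if
`k = j`. These coefficients are the entries of the dependency matrix, so its operator norm appears
after Cauchy–Schwarz.

Let `R` be the second term of the bound. Taking `ρ = R / 2`, the contribution of the rare event is
at most `R / 2` as well. For small `p` this requires replacing `B` by the smaller bound that a
one-point cover forces on the class. The final exponential term is then not needed; it is only added
as a nonnegative quantity. -/

theorem integrable_of_abs_le [IsFiniteMeasure P] {f : Ω → ℝ} (hf : Measurable f) {C : ℝ}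
    (hC : ∀ ω, |f ω| ≤ C) : Integrable f P :=
  Integrable.of_bound hf.aestronglyMeasurable C (Filter.Eventually.of_forall hC)

/-- A version of the conditional expectation of a bounded function obeying the same bounds
everywhere. -/
theorem exists_condExp_version [IsProbabilityMeasure P] (hm : m ≤ mΩ)
    {f : Ω → ℝ} (hf : Measurable f) {lo hi : ℝ} (hlo : ∀ ω, lo ≤ f ω) (hhi : ∀ ω, f ω ≤ hi) :
    ∃ g : Ω → ℝ, Measurable[m] g ∧ (∀ ω, lo ≤ g ω) ∧ (∀ ω, g ω ≤ hi) ∧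
      ∀ u : Ω → ℝ, Measurable[m] u → (∃ C, ∀ ω, |u ω| ≤ C) →
        ∫ ω, f ω * u ω ∂P = ∫ ω, g ω * u ω ∂P := by
  have hfi : Integrable f P := integrable_of_abs_le hf (C := max |lo| |hi|)
    fun ω => abs_le_max_abs_abs (hlo ω) (hhi ω)
  have hlohi : lo ≤ hi := by
    obtain ⟨ω⟩ := P.nonempty_of_neZero
    exact (hlo ω).trans (hhi ω)
  have hg : Measurable[m] (P[f|m]) := stronglyMeasurable_condExp.measurable
  have h1 : ∀ᵐ ω ∂P, lo ≤ (P[f|m]) ω := by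
    have := condExp_mono (m := m) (integrable_const lo) hfi (Filter.Eventually.of_forall hlo)
    rw [condExp_const hm] at this
    exact this
  have h2 : ∀ᵐ ω ∂P, (P[f|m]) ω ≤ hi := by
    have := condExp_mono (m := m) hfi (integrable_const hi) (Filter.Eventually.of_forall hhi)
    rw [condExp_const hm] at this
    exact this
  -- Clamping changes the conditional expectation only on a null set and makes the bounds hold
  -- everywhere.
  refine ⟨fun ω => max lo (min hi ((P[f|m]) ω)), measurable_const.max (measurable_const.min hg),
    fun ω => le_max_left _ _, fun ω => max_le hlohi (min_le_left _ _), ?_⟩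
  rintro u hu ⟨C, hC⟩
  have hfu : Integrable (fun ω => f ω * u ω) P := by
    refine integrable_of_abs_le (hf.mul (hu.mono hm le_rfl)) (C := max |lo| |hi| * C) fun ω => ?_
    rw [abs_mul]
    exact mul_le_mul (abs_le_max_abs_abs (hlo ω) (hhi ω)) (hC ω) (abs_nonneg _)
      ((abs_nonneg _).trans (le_max_left _ _))
  have h3 := condExp_mul_of_stronglyMeasurable_right (μ := P) (m := m) (f := f) (g := u)
    (Measurable.stronglyMeasurable hu) hfu hfi
  rw [← integral_condExp hm (f := fun ω => f ω * u ω)]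
  refine integral_congr_ae ?_
  filter_upwards [h1, h2, h3] with ω a1 a2 a3
  have : (P[fun ω => f ω * u ω|m]) ω = (P[f|m]) ω * u ω := a3
  rw [this, min_eq_right a2, max_eq_right a1]

/-- A function whose integrals over its level sets are nonpositive is nonpositive. -/
theorem ae_nonpos_of_setIntegral_nonpos [IsFiniteMeasure P] (hm : m ≤ mΩ)
    {f : Ω → ℝ} (hf : Measurable[m] f) (hfi : Integrable f P)
    (h : ∀ A, MeasurableSet[m] A → ∫ ω in A, f ω ∂P ≤ 0) : ∀ᵐ ω ∂P, f ω ≤ 0 := by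
  have hA : MeasurableSet[m] {ω | 0 < f ω} :=
    measurableSet_lt measurable_const hf
  have h0 : 0 ≤ᵐ[P.restrict {ω | 0 < f ω}] f := by
    filter_upwards [ae_restrict_mem (hm _ hA)] with ω hω
    exact le_of_lt hω
  have h1 : ∫ ω in {ω | 0 < f ω}, f ω ∂P = 0 := le_antisymm (h _ hA) (integral_nonneg_of_ae h0)
  have h2 := (integral_eq_zero_iff_of_nonneg_ae h0 hfi.integrableOn).1 h1
  rw [Filter.EventuallyEq, ae_restrict_iff' (hm _ hA)] at h2
  filter_upwards [h2] with ω hω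
  by_contra hc
  push Not at hc
  exact absurd (hω hc) hc.ne'

/-- A quadratic transport inequality: if `μ E - ν E ≤ γ` for all `E`, the means of a
`[0,1]`-valued function under `μ` and `ν` are close relative to its second moment. -/
theorem integral_sub_integral_le_of_measure_sub_le {S : Type*} [MeasurableSpace S]
    (μ ν : Measure S) [IsFiniteMeasure μ] [IsFiniteMeasure ν] {γ : ℝ}
    (hγ : ∀ E, MeasurableSet E → μ.real E - ν.real E ≤ γ) {h : S → ℝ} (hh : Measurable h)
    (h0 : ∀ x, 0 ≤ h x) (h1 : ∀ x, h x ≤ 1) {s : ℝ} (hs : 0 ≤ s) :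
    2 * s * ∫ x, h x ∂μ - ∫ x, h x ^ 2 ∂μ ≤ 2 * s * ∫ x, h x ∂ν + γ * s ^ 2 := by
  obtain ⟨E, hE⟩ := exists_isHahnDecomposition ν μ
  have ih : ∀ (ρ : Measure S) [IsFiniteMeasure ρ], Integrable h ρ := fun ρ _ =>
    integrable_of_abs_le hh (C := 1) fun x => by rw [abs_of_nonneg (h0 x)]; exact h1 x
  have ih2 : ∀ (ρ : Measure S) [IsFiniteMeasure ρ], Integrable (fun x => h x ^ 2) ρ := fun ρ _ =>
    integrable_of_abs_le (hh.pow_const 2) (C := 1) fun x => by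
      rw [abs_of_nonneg (sq_nonneg _)]; exact pow_le_one₀ (h0 x) (h1 x)
  -- On `E`, where `ν ≤ μ`, the nonnegative function `(s - h) ^ 2` is integrated; expanding it gives
  -- the quadratic gain. On the complement, where `μ ≤ ν`, the linear terms compare directly.
  have key : ∫ x in E, (s - h x) ^ 2 ∂ν ≤ ∫ x in E, (s - h x) ^ 2 ∂μ := by
    refine integral_mono_measure hE.le_on (Filter.Eventually.of_forall fun x => sq_nonneg _) ?_
    refine ((integrable_const (s ^ 2)).sub (((ih _).const_mul (2 * s)).sub (ih2 _))).congr ?_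
    exact Filter.Eventually.of_forall fun x => by simp only [Pi.sub_apply]; ring
  have expand : ∀ (ρ : Measure S) [IsFiniteMeasure ρ], ∫ x in E, (s - h x) ^ 2 ∂ρ =
      s ^ 2 * ρ.real E - (2 * s * ∫ x in E, h x ∂ρ - ∫ x in E, h x ^ 2 ∂ρ) := by
    intro ρ _
    rw [← integral_const_mul, ← integral_sub ((ih _).const_mul _) (ih2 _)]
    have : s ^ 2 * ρ.real E = ∫ x in E, s ^ 2 ∂ρ := by
      rw [setIntegral_const, smul_eq_mul, mul_comm]
    have i2 : Integrable (fun x => 2 * s * h x - h x ^ 2) (ρ.restrict E) :=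
      ((ih _).const_mul _).sub (ih2 _)
    rw [this, ← integral_sub (integrable_const _) i2]
    exact integral_congr_ae (Filter.Eventually.of_forall fun x => by dsimp only; ring)
  rw [expand μ, expand ν] at key
  have compl : ∫ x in Eᶜ, h x ∂μ ≤ ∫ x in Eᶜ, h x ∂ν :=
    integral_mono_measure hE.ge_on_compl (Filter.Eventually.of_forall h0) (ih _)
  have e1 := integral_add_compl hE.measurableSet (ih μ)
  have e2 := integral_add_compl hE.measurableSet (ih ν)
  have e3 := integral_add_compl hE.measurableSet (ih2 μ)
  have n1 : 0 ≤ ∫ x in Eᶜ, h x ^ 2 ∂μ := integral_nonneg fun x => sq_nonneg _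
  have n2 : 0 ≤ ∫ x in E, h x ^ 2 ∂ν := integral_nonneg fun x => sq_nonneg _
  have hg := mul_le_mul_of_nonneg_right (hγ E hE.measurableSet) (sq_nonneg s)
  have hc := mul_le_mul_of_nonneg_left compl (by positivity : 0 ≤ 2 * s)
  rw [← e1, ← e2, ← e3]
  nlinarith

end Bounded

/-! ### Mixing coefficients and conditional laws of a single later observation. -/

section Mixing

theorem pastSigma_mono {Ω S : Type*} [MeasurableSpace S] (Z : ℕ → Ω → S)
    {i j : ℕ} (hij : i ≤ j) : pastSigma Z i ≤ pastSigma Z j :=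
  iSup₂_le fun k hk => le_iSup₂_of_le (f := fun k (_ : k ∈ Set.Iic j) =>
    MeasurableSpace.comap (Z k) inferInstance) k (le_trans hk hij) le_rfl

theorem comap_le_pastSigma {Ω S : Type*} [MeasurableSpace S] (Z : ℕ → Ω → S)
    {i j : ℕ} (hij : i ≤ j) :
    MeasurableSpace.comap (Z i) inferInstance ≤ pastSigma Z j :=
  le_iSup₂_of_le (f := fun k (_ : k ∈ Set.Iic j) =>
    MeasurableSpace.comap (Z k) inferInstance) i hij le_rfl

variable {Ω S : Type*} [MeasurableSpace Ω] [MeasurableSpace S]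

theorem abs_measureReal_sub_le_one {α : Type*} [MeasurableSpace α] (μ ν : Measure α)
    [IsProbabilityMeasure μ] [IsProbabilityMeasure ν] (E : Set α) : |μ.real E - ν.real E| ≤ 1 := by
  have := measureReal_le_one (μ := μ) (s := E)
  have := measureReal_le_one (μ := ν) (s := E)
  have := measureReal_nonneg (μ := μ) (s := E)
  have := measureReal_nonneg (μ := ν) (s := E)
  rw [abs_le]; constructor <;> linarith

/-- An unbounded real supremum would default to 0; this bound makes the suprema in `tvDist` and
`mixingCoeff` genuine upper bounds. -/
theorem tvDist_le_one {α : Type*} [MeasurableSpace α] (μ ν : Measure α)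
    [IsProbabilityMeasure μ] [IsProbabilityMeasure ν] : tvDist μ ν ≤ 1 :=
  have : Nonempty {A : Set α // MeasurableSet A} := ⟨∅, MeasurableSet.empty⟩
  ciSup_le fun A => abs_measureReal_sub_le_one μ ν A

theorem abs_measureReal_sub_le_tvDist {α : Type*} [MeasurableSpace α] (μ ν : Measure α)
    [IsProbabilityMeasure μ] [IsProbabilityMeasure ν] {E : Set α} (hE : MeasurableSet E) :
    |μ.real E - ν.real E| ≤ tvDist μ ν :=
  le_ciSup (f := fun A : {A : Set α // MeasurableSet A} => |μ.real A.1 - ν.real A.1|)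
    ⟨1, by rintro _ ⟨A, rfl⟩; exact abs_measureReal_sub_le_one μ ν A⟩ ⟨E, hE⟩

theorem measurable_segment {Z : ℕ → Ω → S} (hZ : ∀ t, Measurable (Z t)) (j T : ℕ) :
    Measurable (segment Z j T) :=
  measurable_pi_lambda _ fun k => hZ k

theorem pastSigma_le {Z : ℕ → Ω → S} (hZ : ∀ t, Measurable (Z t)) (i : ℕ) :
    pastSigma Z i ≤ (inferInstance : MeasurableSpace Ω) :=
  iSup₂_le fun k _ => (hZ k).comap_le

/-- An event about `Z j` is a cylinder event of the segment starting at `j`, so total variation of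
segments controls the marginal. -/
theorem abs_cond_sub_le_mixingCoeff {P : Measure Ω} [IsProbabilityMeasure P] {Z : ℕ → Ω → S}
    (hZ : ∀ t, Measurable (Z t)) {T i j : ℕ} (hj : j < T) {A : Set Ω}
    (hA : MeasurableSet[pastSigma Z i] A) (hPA : P A ≠ 0) {E : Set S} (hE : MeasurableSet E) :
    |(P[|A]).real (Z j ⁻¹' E) - P.real (Z j ⁻¹' E)| ≤ mixingCoeff P Z T i j := by
  have hseg := measurable_segment hZ j T
  let jj : Set.Ico j T := ⟨j, le_rfl, hj⟩
  have hE' : MeasurableSet ((fun y : Set.Ico j T → S => y jj) ⁻¹' E) := measurable_pi_apply jj hE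
  have prob : ∀ B : {A : Set Ω // MeasurableSet[pastSigma Z i] A ∧ P A ≠ 0},
      IsProbabilityMeasure ((P[|B.1]).map (segment Z j T)) := fun B =>
    have := cond_isProbabilityMeasure B.2.2
    Measure.isProbabilityMeasure_map hseg.aemeasurable
  have : IsProbabilityMeasure (P.map (segment Z j T)) :=
    Measure.isProbabilityMeasure_map hseg.aemeasurable
  have := prob ⟨A, hA, hPA⟩
  have h1 := abs_measureReal_sub_le_tvDist ((P[|A]).map (segment Z j T))
    (P.map (segment Z j T)) hE'
  rw [map_measureReal_apply hseg hE', map_measureReal_apply hseg hE'] at h1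
  refine le_trans h1 ?_
  exact le_ciSup (f := fun B : {A : Set Ω // MeasurableSet[pastSigma Z i] A ∧ P A ≠ 0} =>
    tvDist ((P[|B.1]).map (segment Z j T)) (P.map (segment Z j T)))
    ⟨1, by rintro _ ⟨B, rfl⟩; have := prob B; exact tvDist_le_one _ _⟩ ⟨A, hA, hPA⟩

theorem mixingCoeff_nonneg (P : Measure Ω) (Z : ℕ → Ω → S) (T i j : ℕ) :
    0 ≤ mixingCoeff P Z T i j :=
  Real.iSup_nonneg fun _ => Real.iSup_nonneg fun _ => abs_nonneg _

/-- The quadratic transport bound between two conditional laws of `Z j` given events of the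
past. -/
theorem cond_integral_sub_le {P : Measure Ω} [IsProbabilityMeasure P] {Z : ℕ → Ω → S}
    (hZ : ∀ t, Measurable (Z t)) {T i j : ℕ} (hj : j < T) {A A' : Set Ω}
    (hA : MeasurableSet[pastSigma Z i] A) (hPA : P A ≠ 0)
    (hA' : MeasurableSet[pastSigma Z i] A') (hPA' : P A' ≠ 0) {h : Ω → ℝ}
    (hh : Measurable[MeasurableSpace.comap (Z j) inferInstance] h)
    (h0 : ∀ ω, 0 ≤ h ω) (h1 : ∀ ω, h ω ≤ 1) {s : ℝ} (hs : 0 ≤ s) :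
    2 * s * ∫ ω, h ω ∂(P[|A]) - ∫ ω, h ω ^ 2 ∂(P[|A]) ≤
      2 * s * ∫ ω, h ω ∂(P[|A']) + 2 * mixingCoeff P Z T i j * s ^ 2 := by
  obtain ⟨g, hg, rfl⟩ := hh.exists_eq_measurable_comp
  have := cond_isProbabilityMeasure hPA
  have := cond_isProbabilityMeasure hPA'
  -- `g` is controlled only on the range of `Z j`; the clamped version lies in `[0,1]` everywhere.
  let k : S → ℝ := fun x => max 0 (min 1 (g x))
  have hk : Measurable k := measurable_const.max (measurable_const.min hg)
  have hgk : ∀ ω, g (Z j ω) = k (Z j ω) := fun ω => by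
    have a := h0 ω; have b := h1 ω
    simp only [Function.comp] at a b
    simp only [k]; rw [min_eq_right b, max_eq_right a]
  -- Both conditional laws are within `mixingCoeff` of the unconditional one. The triangle
  -- inequality costs the factor 2 that stands under the root in `dependencyMatrix`.
  have := integral_sub_integral_le_of_measure_sub_le ((P[|A]).map (Z j)) ((P[|A']).map (Z j))
    (γ := 2 * mixingCoeff P Z T i j) (fun E hE => by
      rw [map_measureReal_apply (hZ j) hE, map_measureReal_apply (hZ j) hE]
      have a1 := (abs_le.1 (abs_cond_sub_le_mixingCoeff hZ hj hA hPA hE)).2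
      have a2 := (abs_le.1 (abs_cond_sub_le_mixingCoeff hZ hj hA' hPA' hE)).1
      linarith) hk (fun x => le_max_left _ _)
      (fun x => max_le zero_le_one (min_le_left _ _)) hs
  rw [integral_map (hZ j).aemeasurable hk.aestronglyMeasurable,
    integral_map (hZ j).aemeasurable hk.aestronglyMeasurable,
    integral_map (hZ j).aemeasurable (hk.pow_const 2).aestronglyMeasurable] at this
  simpa only [Function.comp, hgk] using this

end Mixing

/-! ### Closure properties of bounded measurable functions. -/

section BddMeasurable

/-- Bounded real functions measurable for the σ-algebra `m`. -/
def IsBddMeas {Ω : Type*} (m : MeasurableSpace Ω) (f : Ω → ℝ) : Prop :=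
  Measurable[m] f ∧ ∃ C, ∀ ω, |f ω| ≤ C

variable {Ω : Type*} {m mΩ : MeasurableSpace Ω} {P : Measure Ω} {f g : Ω → ℝ}

theorem IsBddMeas.mono (hf : IsBddMeas m f) (hm : m ≤ mΩ) : IsBddMeas mΩ f :=
  ⟨hf.1.mono hm le_rfl, hf.2⟩

theorem IsBddMeas.integrable [IsFiniteMeasure P] (hf : IsBddMeas mΩ f) : Integrable f P := by
  obtain ⟨h, C, hC⟩ := hf
  exact integrable_of_abs_le h hC

theorem isBddMeas_of_mem_Icc (hf : Measurable[m] f) {lo hi : ℝ} (h0 : ∀ ω, lo ≤ f ω)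
    (h1 : ∀ ω, f ω ≤ hi) : IsBddMeas m f :=
  ⟨hf, max |lo| |hi|, fun ω => abs_le_max_abs_abs (h0 ω) (h1 ω)⟩

theorem isBddMeas_const (m : MeasurableSpace Ω) (c : ℝ) : IsBddMeas m (fun _ : Ω => c) :=
  ⟨measurable_const, |c|, fun _ => le_rfl⟩

theorem IsBddMeas.add (hf : IsBddMeas m f) (hg : IsBddMeas m g) :
    IsBddMeas m (fun ω => f ω + g ω) := by
  obtain ⟨h, C, hC⟩ := hf
  obtain ⟨h', C', hC'⟩ := hg
  exact ⟨h.add h', C + C', fun ω => (abs_add_le _ _).trans (add_le_add (hC ω) (hC' ω))⟩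

theorem IsBddMeas.mul (hf : IsBddMeas m f) (hg : IsBddMeas m g) :
    IsBddMeas m (fun ω => f ω * g ω) := by
  obtain ⟨h, C, hC⟩ := hf
  obtain ⟨h', C', hC'⟩ := hg
  refine ⟨h.mul h', C * C', fun ω => ?_⟩
  rw [abs_mul]
  exact mul_le_mul (hC ω) (hC' ω) (abs_nonneg _) ((abs_nonneg _).trans (hC ω))

theorem IsBddMeas.const_mul (c : ℝ) (hf : IsBddMeas m f) : IsBddMeas m (fun ω => c * f ω) :=
  (isBddMeas_const m c).mul hf

theorem IsBddMeas.sub (hf : IsBddMeas m f) (hg : IsBddMeas m g) :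
    IsBddMeas m (fun ω => f ω - g ω) := by
  have := hf.add (hg.const_mul (-1))
  simpa only [neg_one_mul, ← sub_eq_add_neg] using this

theorem IsBddMeas.sq (hf : IsBddMeas m f) : IsBddMeas m (fun ω => f ω ^ 2) := by
  simpa only [pow_two] using hf.mul hf

theorem IsBddMeas.posPart (hf : IsBddMeas m f) : IsBddMeas m (fun ω => max (f ω) 0) := by
  obtain ⟨h, C, hC⟩ := hf
  refine ⟨h.max measurable_const, C, fun ω => ?_⟩
  rw [abs_of_nonneg (le_max_right _ _)]
  exact max_le ((le_abs_self _).trans (hC ω)) ((abs_nonneg _).trans (hC ω))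

theorem IsBddMeas.div (hf : IsBddMeas m f) (hg : IsBddMeas m g) {lo : ℝ} (hlo : 0 < lo)
    (hg0 : ∀ ω, lo ≤ g ω) : IsBddMeas m (fun ω => f ω / g ω) := by
  have : IsBddMeas m (fun ω => (g ω)⁻¹) := by
    refine ⟨hg.1.inv, lo⁻¹, fun ω => ?_⟩
    rw [abs_of_nonneg (inv_nonneg.2 (hlo.le.trans (hg0 ω)))]
    exact inv_anti₀ hlo (hg0 ω)
  simpa only [div_eq_mul_inv] using hf.mul this

theorem IsBddMeas.log (hf : IsBddMeas m f) {lo : ℝ} (hlo : 0 < lo)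
    (hf0 : ∀ ω, lo ≤ f ω) : IsBddMeas m (fun ω => Real.log (f ω)) := by
  obtain ⟨h, C, hC⟩ := hf
  exact isBddMeas_of_mem_Icc h.log (fun ω => Real.log_le_log hlo (hf0 ω))
    (fun ω => Real.log_le_log (hlo.trans_le (hf0 ω)) ((le_abs_self _).trans (hC ω)))

theorem integral_mul_le_sqrt_mul_sqrt [IsFiniteMeasure P] (hf : IsBddMeas mΩ f)
    (hg : IsBddMeas mΩ g) :
    ∫ ω, f ω * g ω ∂P ≤ Real.sqrt (∫ ω, f ω ^ 2 ∂P) * Real.sqrt (∫ ω, g ω ^ 2 ∂P) := by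
  have hquad : ∀ t : ℝ, 0 ≤ (∫ ω, g ω ^ 2 ∂P) * (t * t) + (-2 * ∫ ω, f ω * g ω ∂P) * t +
      ∫ ω, f ω ^ 2 ∂P := by
    intro t
    have h0 : 0 ≤ ∫ ω, (t * g ω - f ω) ^ 2 ∂P := integral_nonneg fun ω => sq_nonneg _
    have : ∫ ω, (t * g ω - f ω) ^ 2 ∂P = t ^ 2 * ∫ ω, g ω ^ 2 ∂P -
        2 * t * ∫ ω, f ω * g ω ∂P + ∫ ω, f ω ^ 2 ∂P := by
      rw [← integral_const_mul, ← integral_const_mul,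
        ← integral_sub (hg.sq.const_mul _).integrable ((hf.mul hg).const_mul _).integrable,
        ← integral_add ((hg.sq.const_mul _).sub ((hf.mul hg).const_mul _)).integrable
          hf.sq.integrable]
      exact integral_congr_ae (Filter.Eventually.of_forall fun ω => by dsimp only; ring)
    rw [this] at h0
    linarith
  have hd := discrim_le_zero hquad
  rw [discrim] at hd
  rw [← Real.sqrt_mul (integral_nonneg fun ω => sq_nonneg _)]
  refine Real.le_sqrt_of_sq_le ?_
  linarith

end BddMeasurable

/-! ### Entropy increments and chains of densities. -/

section Chain

variable {Ω : Type*} {m mΩ : MeasurableSpace Ω} {P : Measure Ω} [IsProbabilityMeasure P]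

/-- Only the downward deviation of a density from 1 is compared with entropy. This is why the later
tail bound is one-sided, with a second moment and no further correction. -/
theorem sq_posPart_one_sub_le {x : ℝ} (hx : 0 < x) :
    (max (1 - x) 0) ^ 2 ≤ 2 * (x * Real.log x - x + 1) := by
  rcases le_or_gt 1 x with h | h
  · rw [max_eq_right (by linarith)]
    have := Real.one_sub_inv_le_log_of_pos hx
    have h2 : x * (1 - x⁻¹) ≤ x * Real.log x := mul_le_mul_of_nonneg_left this hx.le
    have h3 : x * (1 - x⁻¹) = x - 1 := by field_simp
    linarith
  · rw [max_eq_left (by linarith)]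
    have h1 : 0 ≤ Real.log x⁻¹ := Real.log_nonneg (one_le_inv₀ hx |>.2 h.le)
    -- With `y = -log x ≥ 0`, the bound `y ≤ sinh y` reads `-x log x ≤ (1 - x ^ 2) / 2`, which
    -- rearranges to the claim.
    have h2 := Real.self_le_sinh_iff.2 h1
    rw [Real.sinh_eq, Real.exp_log (inv_pos.2 hx), Real.log_inv, neg_neg, Real.exp_log hx] at h2
    have h3 : x * (-Real.log x) ≤ x * ((x⁻¹ - x) / 2) := mul_le_mul_of_nonneg_left h2 hx.le
    have h4 : x * ((x⁻¹ - x) / 2) = (1 - x ^ 2) / 2 := by field_simp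
    nlinarith

theorem sq_posPart_sub_div_le {u v : ℝ} (hu : 0 < u) (hv : 0 < v) :
    (max (u - v) 0) ^ 2 / u ≤ 2 * (v * Real.log v - v * Real.log u - v + u) := by
  have h := sq_posPart_one_sub_le (div_pos hv hu)
  have e1 : max (1 - v / u) 0 = max (u - v) 0 / u := by
    rw [← max_div_div_right hu.le, zero_div, sub_div, div_self hu.ne']
  rw [e1, Real.log_div hv.ne' hu.ne'] at h
  have h2 := mul_le_mul_of_nonneg_right h hu.le
  have e2 : (max (u - v) 0 / u) ^ 2 * u = (max (u - v) 0) ^ 2 / u := by field_simp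
  have e3 : 2 * (v / u * (Real.log v - Real.log u) - v / u + 1) * u =
    2 * (v * Real.log v - v * Real.log u - v + u) := by field_simp
  rwa [e2, e3] at h2

/-- The quadratic distance between two consecutive conditional densities is controlled by the
increment of entropy. -/
theorem integral_sq_posPart_sub_div_le (hm : m ≤ mΩ) {a b : Ω → ℝ} (ha : IsBddMeas m a)
    (hb : IsBddMeas mΩ b) {lo : ℝ} (hlo : 0 < lo) (ha0 : ∀ ω, lo ≤ a ω) (hb0 : ∀ ω, lo ≤ b ω)
    (hab : ∀ u : Ω → ℝ, IsBddMeas m u → ∫ ω, b ω * u ω ∂P = ∫ ω, a ω * u ω ∂P) :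
    ∫ ω, (max (a ω - b ω) 0) ^ 2 / a ω ∂P ≤
      2 * (∫ ω, b ω * Real.log (b ω) ∂P - ∫ ω, a ω * Real.log (a ω) ∂P) := by
  have ha' := ha.mono hm
  have hla := ha.log hlo ha0
  -- Testing `hab` on `log a` replaces `∫ a log a` by `∫ b log a`: the entropy increment becomes the
  -- relative entropy of `b` with respect to `a`.
  have e1 := hab _ hla
  have e2 := hab _ (isBddMeas_const m 1)
  simp only [mul_one] at e2
  have i1 := hb.mul (hb.log hlo hb0)
  have i2 := hb.mul (hla.mono hm)
  rw [← e1]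
  have : ∫ ω, b ω * Real.log (b ω) ∂P - ∫ ω, b ω * Real.log (a ω) ∂P =
      ∫ ω, (b ω * Real.log (b ω) - b ω * Real.log (a ω) - b ω + a ω) ∂P := by
    rw [integral_add ((i1.sub i2).sub hb).integrable ha'.integrable,
      integral_sub (i1.sub i2).integrable hb.integrable,
      integral_sub i1.integrable i2.integrable, e2]
    ring
  rw [this, ← integral_const_mul]
  refine integral_mono ((ha'.sub hb).posPart.sq.div ha' hlo ha0).integrable
    ((((i1.sub i2).sub hb).add ha').const_mul 2).integrable fun ω => ?_
  exact sq_posPart_sub_div_le (hlo.trans_le (ha0 ω)) (hlo.trans_le (hb0 ω))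

/-- The mass of `G` lost along a chain of densities. -/
theorem integral_mul_one_sub_le_sum {G : Ω → ℝ} (hG : IsBddMeas mΩ G) (hG0 : ∀ ω, 0 ≤ G ω)
    {w : ℕ → Ω → ℝ} (hw : ∀ k, IsBddMeas mΩ (w k)) {lo : ℝ} (hlo : 0 < lo)
    (hw0 : ∀ k ω, lo ≤ w k ω) (hw1 : ∀ ω, w 0 ω = 1) (n : ℕ) :
    ∫ ω, G ω * (1 - w n ω) ∂P ≤ Real.sqrt (∫ ω, G ω ^ 2 ∂P) * ∑ k ∈ Finset.range n,
      Real.sqrt (∫ ω, w k ω * (max (1 - w (k + 1) ω / w k ω) 0) ^ 2 ∂P) := by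
  let h : ℕ → Ω → ℝ := fun k ω => max (1 - w (k + 1) ω / w k ω) 0
  have hwp : ∀ k ω, 0 < w k ω := fun k ω => hlo.trans_le (hw0 k ω)
  have hh : ∀ k, IsBddMeas mΩ (h k) := fun k =>
    ((isBddMeas_const mΩ 1).sub ((hw _).div (hw k) hlo (hw0 k))).posPart
  have hh0 : ∀ k ω, 0 ≤ h k ω := fun k ω => le_max_right _ _
  have hh1 : ∀ k ω, h k ω ≤ 1 := fun k ω =>
    max_le (by linarith [div_pos (hwp (k + 1) ω) (hwp k ω)]) zero_le_one
  -- `μ` is the product of the factors `1 - h k`, the mass of the initial law kept at every step. It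
  -- stays below both 1 and `w n`, since upward moves of the density are ignored.
  suffices H : ∀ n, ∃ μ : Ω → ℝ, IsBddMeas mΩ μ ∧ (∀ ω, 0 ≤ μ ω) ∧ (∀ ω, μ ω ≤ 1) ∧
      (∀ ω, μ ω ≤ w n ω) ∧
      ∫ ω, G ω * (1 - μ ω) ∂P ≤ Real.sqrt (∫ ω, G ω ^ 2 ∂P) * ∑ k ∈ Finset.range n,
        Real.sqrt (∫ ω, w k ω * (h k ω) ^ 2 ∂P) by
    obtain ⟨μ, b, -, -, b1, b2⟩ := H n
    refine le_trans (integral_mono (hG.mul ((isBddMeas_const _ 1).sub (hw n))).integrable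
      (hG.mul ((isBddMeas_const _ 1).sub b)).integrable fun ω => ?_) b2
    exact mul_le_mul_of_nonneg_left (by linarith [b1 ω]) (hG0 ω)
  intro n
  induction n with
  | zero => exact ⟨fun _ => 1, isBddMeas_const _ 1, fun _ => zero_le_one, fun _ => le_rfl,
      fun ω => (hw1 ω).ge, by simp⟩
  | succ n ih =>
    obtain ⟨μ, b, p0, p1, pw, b2⟩ := ih
    have bn := b.mul ((isBddMeas_const mΩ 1).sub (hh n))
    refine ⟨fun ω => μ ω * (1 - h n ω), bn,
      fun ω => mul_nonneg (p0 ω) (by linarith [hh1 n ω]),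
      fun ω => mul_le_one₀ (p1 ω) (by linarith [hh1 n ω]) (by linarith [hh0 n ω]), ?_, ?_⟩
    · intro ω
      rcases le_total (w (n + 1) ω) (w n ω) with hle | hle
      · have : h n ω = 1 - w (n + 1) ω / w n ω :=
          max_eq_left (by linarith [(div_le_one (hwp n ω)).2 hle])
        dsimp only
        rw [this, sub_sub_cancel]
        calc μ ω * (w (n + 1) ω / w n ω) ≤ w n ω * (w (n + 1) ω / w n ω) :=
              mul_le_mul_of_nonneg_right (pw ω) (div_pos (hwp _ ω) (hwp _ ω)).le
          _ = w (n + 1) ω := mul_div_cancel₀ _ (hwp n ω).ne'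
      · calc μ ω * (1 - h n ω) ≤ μ ω * 1 :=
              mul_le_mul_of_nonneg_left (by linarith [hh0 n ω]) (p0 ω)
          _ ≤ w (n + 1) ω := by rw [mul_one]; exact (pw ω).trans hle
    · rw [Finset.sum_range_succ, mul_add]
      have e : ∫ ω, G ω * (1 - μ ω * (1 - h n ω)) ∂P =
          ∫ ω, G ω * (1 - μ ω) ∂P + ∫ ω, G ω * (μ ω * h n ω) ∂P := by
        rw [← integral_add (hG.mul ((isBddMeas_const _ 1).sub b)).integrable
          (hG.mul (b.mul (hh n))).integrable]
        exact integral_congr_ae (Filter.Eventually.of_forall fun ω => by dsimp only; ring)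
      rw [e]
      refine add_le_add b2 ((integral_mul_le_sqrt_mul_sqrt hG (b.mul (hh n))).trans ?_)
      refine mul_le_mul_of_nonneg_left (Real.sqrt_le_sqrt ?_) (Real.sqrt_nonneg _)
      refine integral_mono (b.mul (hh n)).sq.integrable ((hw n).mul (hh n).sq).integrable fun ω => ?_
      dsimp only
      rw [mul_pow]
      refine mul_le_mul_of_nonneg_right ?_ (sq_nonneg _)
      -- `μ ≤ 1` and `μ ≤ w n` give `μ ^ 2 ≤ w n`.
      nlinarith [p0 ω, p1 ω, pw ω]

end Chain

/-! ### Influence of one revealed observation on a later one. -/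

section Step

variable {Ω S : Type*} [mΩ : MeasurableSpace Ω] [MeasurableSpace S] {P : Measure Ω}
  [IsProbabilityMeasure P]

theorem integral_cond_eq (P : Measure Ω) {A : Set Ω} (f : Ω → ℝ) :
    ∫ ω, f ω ∂(P[|A]) = (P.real A)⁻¹ * ∫ ω in A, f ω ∂P := by
  rw [ProbabilityTheory.cond, integral_smul_measure, ENNReal.toReal_inv, smul_eq_mul]
  rfl

/-- The influence of a change of the conditional law at time `i` on the law at a later time. -/
theorem integral_two_mul_sub_sq_le_mixingCoeff {Z : ℕ → Ω → S} (hZ : ∀ t, Measurable (Z t))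
    {T i j : ℕ} (hj : j < T) {a b h : Ω → ℝ} (ha : IsBddMeas (pastSigma Z i) a)
    (hb : IsBddMeas (pastSigma Z i) b) (ha0 : ∀ ω, 0 < a ω)
    (hquot : IsBddMeas mΩ fun ω => (max (a ω - b ω) 0) ^ 2 / a ω)
    (hab : ∫ ω, a ω ∂P = ∫ ω, b ω ∂P)
    (hh : Measurable[MeasurableSpace.comap (Z j) inferInstance] h)
    (h0 : ∀ ω, 0 ≤ h ω) (h1 : ∀ ω, h ω ≤ 1) :
    ∫ ω, (2 * h ω * (a ω - b ω) - h ω ^ 2 * a ω) ∂P ≤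
      2 * mixingCoeff P Z T i j * ∫ ω, (max (a ω - b ω) 0) ^ 2 / a ω ∂P := by
  set γ := 2 * mixingCoeff P Z T i j with hγ
  have hm : pastSigma Z i ≤ mΩ := pastSigma_le hZ i
  have hhm : Measurable h := hh.mono (hZ j).comap_le le_rfl
  have bh : IsBddMeas mΩ h := isBddMeas_of_mem_Icc hhm h0 h1
  obtain ⟨k, km, k0, k1, hk⟩ := exists_condExp_version (P := P) hm hhm h0 h1
  obtain ⟨l, lm, l0, l1, hl⟩ := exists_condExp_version (P := P) hm (hhm.pow_const 2)
    (lo := 0) (hi := 1) (fun ω => sq_nonneg _) (fun ω => pow_le_one₀ (h0 ω) (h1 ω))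
  have bk : IsBddMeas (pastSigma Z i) k := isBddMeas_of_mem_Icc km k0 k1
  have bl : IsBddMeas (pastSigma Z i) l := isBddMeas_of_mem_Icc lm l0 l1
  have bk' := bk.mono hm
  have bl' := bl.mono hm
  have ha' := ha.mono hm
  have hb' := hb.mono hm
  have toSet : ∀ {f g : Ω → ℝ}, (∀ u : Ω → ℝ, Measurable[pastSigma Z i] u →
      (∃ C, ∀ ω, |u ω| ≤ C) → ∫ ω, f ω * u ω ∂P = ∫ ω, g ω * u ω ∂P) →
      ∀ A, MeasurableSet[pastSigma Z i] A → ∫ ω in A, f ω ∂P = ∫ ω in A, g ω ∂P := by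
    intro f g H A hA
    have := H (A.indicator fun _ => 1) ((@measurable_const _ _ _ (pastSigma Z i) 1).indicator hA)
      ⟨1, fun ω => by
        by_cases hω : ω ∈ A
        · rw [Set.indicator_of_mem hω, abs_one]
        · rw [Set.indicator_of_notMem hω, abs_zero]; exact zero_le_one⟩
    rw [← integral_indicator (hm _ hA), ← integral_indicator (hm _ hA)]
    convert this using 2
    all_goals
      ext ω
      by_cases hω : ω ∈ A
      · rw [Set.indicator_of_mem hω, Set.indicator_of_mem hω, mul_one]
      · rw [Set.indicator_of_notMem hω, Set.indicator_of_notMem hω, mul_zero]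
  let ι := {A : Set Ω // MeasurableSet[pastSigma Z i] A ∧ P A ≠ 0}
  -- `c` plays the role of the essential infimum of `k`, the conditional mean of `h` given the past.
  -- Since `a` and `b` have equal integrals, `k` may be replaced by `k - c ≥ 0`.
  let c : ℝ := ⨅ A : ι, ∫ ω, h ω ∂(P[|A.1])
  have hbdd : BddBelow (Set.range fun A : ι => ∫ ω, h ω ∂(P[|A.1])) :=
    ⟨0, by rintro _ ⟨A, rfl⟩; exact integral_nonneg h0⟩
  have hc : ∀ A : ι, c ≤ ∫ ω, h ω ∂(P[|A.1]) := fun A => ciInf_le hbdd A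
  have hcs : ∀ A : ι, ∀ s : ℝ, 0 ≤ s →
      2 * s * ∫ ω, h ω ∂(P[|A.1]) - ∫ ω, h ω ^ 2 ∂(P[|A.1]) ≤ 2 * s * c + γ * s ^ 2 := by
    intro A s hs
    have : Nonempty ι := ⟨A⟩
    rcases hs.eq_or_lt with rfl | hs
    · have : 0 ≤ ∫ ω, h ω ^ 2 ∂(P[|A.1]) := integral_nonneg fun ω => sq_nonneg _
      simpa using this
    · have : (2 * s * ∫ ω, h ω ∂(P[|A.1]) - ∫ ω, h ω ^ 2 ∂(P[|A.1]) - γ * s ^ 2) / (2 * s) ≤ c := by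
        refine le_ciInf fun A' => ?_
        rw [div_le_iff₀ (by positivity)]
        have := cond_integral_sub_le hZ hj A.2.1 A.2.2 A'.2.1 A'.2.2 hh h0 h1 hs.le
        linarith
      rw [div_le_iff₀ (by positivity)] at this
      linarith
  have real_pos : ∀ A : Set Ω, P A ≠ 0 → 0 < P.real A := fun A hA =>
    ENNReal.toReal_pos hA (measure_ne_top _ _)
  have kc : ∀ᵐ ω ∂P, c - k ω ≤ 0 := by
    refine ae_nonpos_of_setIntegral_nonpos hm ((isBddMeas_const _ c).sub bk).1
      ((isBddMeas_const mΩ c).sub bk').integrable fun A hA => ?_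
    by_cases hPA : P A = 0
    · rw [setIntegral_measure_zero _ hPA]
    · have := hc ⟨A, hA, hPA⟩
      rw [integral_cond_eq, toSet hk A hA, inv_mul_eq_div, le_div_iff₀ (real_pos A hPA)] at this
      rw [integral_sub (integrable_const _) bk'.integrable.integrableOn, setIntegral_const,
        smul_eq_mul]
      linarith
  -- Rational `s` give a single null set; continuity in `s` later extends the inequality to all real
  -- `s ≥ 0`. A random `s` can then be inserted.
  have ks : ∀ᵐ ω ∂P, ∀ s : ℚ, 0 ≤ s →
      2 * (s : ℝ) * (k ω - c) - l ω - γ * (s : ℝ) ^ 2 ≤ 0 := by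
    rw [ae_all_iff]
    intro s
    by_cases hs : 0 ≤ s
    swap
    · exact Filter.Eventually.of_forall fun ω h => absurd h hs
    have b : IsBddMeas (pastSigma Z i)
        (fun ω => 2 * (s : ℝ) * (k ω - c) - l ω - γ * (s : ℝ) ^ 2) :=
      (((bk.sub (isBddMeas_const _ c)).const_mul _).sub bl).sub (isBddMeas_const _ _)
    refine (ae_nonpos_of_setIntegral_nonpos (P := P) hm b.1 (b.mono hm).integrable
      fun A hA => ?_).mono fun ω h _ => h
    by_cases hPA : P A = 0
    · rw [setIntegral_measure_zero _ hPA]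
    · have h2 := hcs ⟨A, hA, hPA⟩ s (by exact_mod_cast hs)
      rw [integral_cond_eq, integral_cond_eq, toSet hk A hA, toSet hl A hA] at h2
      have i1 : Integrable (fun ω => 2 * (s : ℝ) * (k ω - c)) (P.restrict A) :=
        ((bk'.sub (isBddMeas_const _ c)).const_mul _).integrable
      have i2 : Integrable (fun ω => 2 * (s : ℝ) * (k ω - c) - l ω) (P.restrict A) :=
        i1.sub bl'.integrable
      rw [integral_sub i2 (integrable_const _), integral_sub i1 bl'.integrable,
        integral_const_mul, integral_sub bk'.integrable (integrable_const _), setIntegral_const,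
        setIntegral_const, smul_eq_mul, smul_eq_mul]
      have hp := real_pos A hPA
      have h3 := mul_le_mul_of_nonneg_left h2 hp.le
      have e : P.real A * (2 * (s : ℝ) * ((P.real A)⁻¹ * ∫ ω in A, k ω ∂P) -
          (P.real A)⁻¹ * ∫ ω in A, l ω ∂P) = 2 * s * ∫ ω in A, k ω ∂P - ∫ ω in A, l ω ∂P := by
        field_simp
      rw [e] at h3
      linarith
  have split : ∫ ω, (2 * h ω * (a ω - b ω) - h ω ^ 2 * a ω) ∂P =
      ∫ ω, (2 * (k ω - c) * (a ω - b ω) - l ω * a ω) ∂P := by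
    have e1 := hk _ (ha.sub hb).1 (ha.sub hb).2
    have e2 := hl _ ha.1 ha.2
    have i1 := (bh.mul (ha'.sub hb')).const_mul 2
    have i2 := (bk'.mul (ha'.sub hb')).const_mul 2
    have i3 := (ha'.sub hb').const_mul (2 * c)
    have s1 : ∫ ω, (2 * h ω * (a ω - b ω) - h ω ^ 2 * a ω) ∂P =
        2 * ∫ ω, h ω * (a ω - b ω) ∂P - ∫ ω, h ω ^ 2 * a ω ∂P := by
      rw [← integral_const_mul, ← integral_sub i1.integrable (bh.sq.mul ha').integrable]
      exact integral_congr_ae (Filter.Eventually.of_forall fun ω => by dsimp only; ring)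
    have s2 : ∫ ω, (2 * (k ω - c) * (a ω - b ω) - l ω * a ω) ∂P =
        2 * ∫ ω, k ω * (a ω - b ω) ∂P - 2 * c * ∫ ω, (a ω - b ω) ∂P - ∫ ω, l ω * a ω ∂P := by
      rw [← integral_const_mul, ← integral_const_mul, ← integral_sub i2.integrable i3.integrable,
        ← integral_sub (i2.sub i3).integrable (bl'.mul ha').integrable]
      exact integral_congr_ae (Filter.Eventually.of_forall fun ω => by dsimp only; ring)
    rw [s1, s2, e1, e2, integral_sub ha'.integrable hb'.integrable, hab]
    ring
  rw [split, ← integral_const_mul]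
  refine integral_mono_ae ((((bk'.sub (isBddMeas_const _ c)).const_mul 2).mul
    (ha'.sub hb')).sub (bl'.mul ha')).integrable (hquot.const_mul γ).integrable ?_
  filter_upwards [kc, ks] with ω hkc hks
  have hreal : ∀ s : ℝ, 0 ≤ s → 2 * s * (k ω - c) - l ω - γ * s ^ 2 ≤ 0 := by
    intro s hs
    have hcont : Continuous fun s : ℝ => 2 * s * (k ω - c) - l ω - γ * s ^ 2 := by fun_prop
    by_contra hcon
    push Not at hcon
    have hopen := (isOpen_lt continuous_const hcont).mem_nhds hcon
    obtain ⟨ε, hε, hball⟩ := Metric.mem_nhds_iff.1 hopen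
    obtain ⟨r, hr1, hr2⟩ := exists_rat_btwn (show s < s + ε by linarith)
    have hr0 : (0 : ℝ) ≤ r := hs.trans hr1.le
    have := hball (show (r : ℝ) ∈ Metric.ball s ε by
      rw [Metric.mem_ball, Real.dist_eq, abs_lt]; constructor <;> linarith)
    exact absurd (hks r (by exact_mod_cast hr0)) (not_le.2 this)
  have hap := ha0 ω
  -- This `s` satisfies `a * s = max (a - b) 0`; multiplying by `a` turns `γ * s ^ 2` into the
  -- desired quotient.
  have h2 := hreal (max (a ω - b ω) 0 / a ω) (div_nonneg (le_max_right _ _) hap.le)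
  have h3 := mul_le_mul_of_nonneg_left h2 hap.le
  have e : a ω * (2 * (max (a ω - b ω) 0 / a ω) * (k ω - c) - l ω -
      γ * (max (a ω - b ω) 0 / a ω) ^ 2) = 2 * (k ω - c) * max (a ω - b ω) 0 - l ω * a ω -
      γ * ((max (a ω - b ω) 0) ^ 2 / a ω) := by
    field_simp
  rw [e] at h3
  have h4 : 2 * (k ω - c) * (a ω - b ω) ≤ 2 * (k ω - c) * max (a ω - b ω) 0 :=
    mul_le_mul_of_nonneg_left (le_max_left _ _) (by linarith)
  linarith

/-- Completing the square in `h`. This is the diagonal case `k = j`, where no mixing helps, and it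
accounts for the unit diagonal. -/
theorem two_mul_sub_sq_le {a d h : ℝ} (ha : 0 < a) (h0 : 0 ≤ h) :
    2 * h * d - h ^ 2 * a ≤ (max d 0) ^ 2 / a := by
  rw [le_div_iff₀ ha]
  have h1 : 2 * h * d ≤ 2 * h * max d 0 := mul_le_mul_of_nonneg_left (le_max_left _ _) (by linarith)
  nlinarith [sq_nonneg (max d 0 - h * a), mul_le_mul_of_nonneg_right h1 ha.le]

end Step

/-! ### The operator norm as a bound on bilinear forms. -/

section OperatorNorm

theorem matrixOpNorm_nonneg {n : ℕ} (M : Matrix (Fin n) (Fin n) ℝ) : 0 ≤ matrixOpNorm M :=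
  norm_nonneg _

theorem sum_mul_mulVec_le {n : ℕ} (M : Matrix (Fin n) (Fin n) ℝ) (x y : Fin n → ℝ) :
    ∑ i, x i * ∑ j, M i j * y j ≤
      Real.sqrt (∑ i, x i ^ 2) * (matrixOpNorm M * Real.sqrt (∑ i, y i ^ 2)) := by
  let x' : EuclideanSpace ℝ (Fin n) := WithLp.toLp 2 x
  let y' : EuclideanSpace ℝ (Fin n) := WithLp.toLp 2 y
  have h1 : ∑ i, x i * ∑ j, M i j * y j =
      inner ℝ x' (Matrix.toEuclideanCLM (𝕜 := ℝ) M y') := by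
    rw [PiLp.inner_apply]
    refine Finset.sum_congr rfl fun i _ => ?_
    simp [x', y', Matrix.mulVec, dotProduct, mul_comm]
  have h2 : ‖x'‖ = Real.sqrt (∑ i, x i ^ 2) := by
    rw [EuclideanSpace.norm_eq]; simp [x']
  have h3 : ‖y'‖ = Real.sqrt (∑ i, y i ^ 2) := by
    rw [EuclideanSpace.norm_eq]; simp [y']
  rw [h1, ← h2, ← h3]
  exact (real_inner_le_norm _ _).trans
    (mul_le_mul_of_nonneg_left (ContinuousLinearMap.le_opNorm _ _) (norm_nonneg _))

theorem one_le_matrixOpNorm_of_diag {n : ℕ} (M : Matrix (Fin n) (Fin n) ℝ) (i : Fin n)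
    (hi : M i i = 1) : 1 ≤ matrixOpNorm M := by
  have := sum_mul_mulVec_le M (Pi.single i 1) (Pi.single i 1)
  simpa [Pi.single_apply, hi, ite_pow] using this

end OperatorNorm

/-! ### Transport inequality, Laplace transform and lower tail for dependent sums. -/

section Laplace

/-- The σ-algebra of the first `k` observations. -/
@[reducible] def strictPast {Ω S : Type*} [MeasurableSpace S] (Z : ℕ → Ω → S) : ℕ → MeasurableSpace Ω
  | 0 => ⊥
  | k + 1 => pastSigma Z k

theorem strictPast_le_pastSigma {Ω S : Type*} [MeasurableSpace S] (Z : ℕ → Ω → S) (k : ℕ) : strictPast Z k ≤ pastSigma Z k := by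
  cases k with
  | zero => exact bot_le
  | succ k => exact pastSigma_mono Z k.le_succ

variable {Ω S : Type*} [mΩ : MeasurableSpace Ω] [MeasurableSpace S]

theorem strictPast_le {Z : ℕ → Ω → S} (hZ : ∀ t, Measurable (Z t)) (k : ℕ) :
    strictPast Z k ≤ mΩ := by
  cases k with
  | zero => exact bot_le
  | succ k => exact pastSigma_le hZ k

/-- A change of the law by a bounded density moves the sum of the means of nonnegative functions
of the observations down by at most the square root of the relative entropy, up to the operator
norm of the dependency matrix. -/
theorem sum_integral_mul_one_sub_le {P : Measure Ω} [IsProbabilityMeasure P] {Z : ℕ → Ω → S}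
    (hZ : ∀ t, Measurable (Z t)) (T : ℕ) {G : ℕ → Ω → ℝ}
    (hG : ∀ j, IsBddMeas (MeasurableSpace.comap (Z j) inferInstance) (G j))
    (hG0 : ∀ j ω, 0 ≤ G j ω) {D : Ω → ℝ} (hD : Measurable D) {lo hi : ℝ} (hlo : 0 < lo)
    (hlo1 : lo ≤ 1) (hhi1 : 1 ≤ hi) (hDlo : ∀ ω, lo ≤ D ω) (hDhi : ∀ ω, D ω ≤ hi)
    (hD1 : ∫ ω, D ω ∂P = 1) :
    0 ≤ ∫ ω, D ω * Real.log (D ω) ∂P ∧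
    ∑ j ∈ Finset.range T, ∫ ω, G j ω * (1 - D ω) ∂P ≤
      matrixOpNorm (dependencyMatrix P Z T) *
        Real.sqrt (∑ j ∈ Finset.range T, ∫ ω, G j ω ^ 2 ∂P) *
        Real.sqrt (2 * ∫ ω, D ω * Real.log (D ω) ∂P) := by
  have bD : IsBddMeas mΩ D := isBddMeas_of_mem_Icc hD hDlo hDhi
  choose q' qm q0 q1 hq' using fun k =>
    exists_condExp_version (P := P) (pastSigma_le hZ k) hD hDlo hDhi
  -- The index counts revealed observations, so `q 0 = 1` and `q (k + 1)` is `D` conditioned on `Z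
  -- 0, …, Z k`.
  let q : ℕ → Ω → ℝ := fun k => Nat.casesOn k (fun _ => 1) q'
  have qlo : ∀ k ω, lo ≤ q k ω := fun k ω => by
    cases k with
    | zero => exact hlo1
    | succ k => exact q0 k ω
  have qhi : ∀ k ω, q k ω ≤ hi := fun k ω => by
    cases k with
    | zero => exact hhi1
    | succ k => exact q1 k ω
  have bq : ∀ k, IsBddMeas (strictPast Z k) (q k) := fun k => by
    cases k with
    | zero => exact isBddMeas_const _ 1
    | succ k => exact isBddMeas_of_mem_Icc (qm k) (q0 k) (q1 k)
  have bqΩ : ∀ k, IsBddMeas mΩ (q k) := fun k => (bq k).mono (strictPast_le hZ k)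
  have qD : ∀ k, ∀ u : Ω → ℝ, IsBddMeas (strictPast Z k) u →
      ∫ ω, D ω * u ω ∂P = ∫ ω, q k ω * u ω ∂P := fun k u hu => by
    cases k with
    | zero =>
      obtain ⟨c, rfl⟩ := stronglyMeasurable_bot_iff.1 (Measurable.stronglyMeasurable hu.1)
      change ∫ ω, D ω * c ∂P = ∫ ω, 1 * c ∂P
      rw [integral_mul_const, hD1, integral_mul_const]
      simp
    | succ k => exact hq' k u hu.1 hu.2
  have qstep : ∀ k, ∀ u : Ω → ℝ, IsBddMeas (strictPast Z k) u →
      ∫ ω, q (k + 1) ω * u ω ∂P = ∫ ω, q k ω * u ω ∂P := fun k u hu => by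
    rw [← qD k u hu, ← qD (k + 1) u (hu.mono (strictPast_le_pastSigma Z k))]
  have qint : ∀ k, ∫ ω, q k ω ∂P = 1 := fun k => by
    have := qD k _ (isBddMeas_const _ 1)
    simp only [mul_one] at this
    rw [← this, hD1]
  have qpos : ∀ k ω, 0 < q k ω := fun k ω => hlo.trans_le (qlo k ω)
  have bquot : ∀ k, IsBddMeas mΩ fun ω => (max (q k ω - q (k + 1) ω) 0) ^ 2 / q k ω := fun k =>
    ((bqΩ k).sub (bqΩ (k + 1))).posPart.sq.div (bqΩ k) hlo (qlo k)
  let e : ℕ → ℝ := fun k => ∫ ω, (max (q k ω - q (k + 1) ω) 0) ^ 2 / q k ω ∂P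
  have e0 : ∀ k, 0 ≤ e k := fun k =>
    integral_nonneg fun ω => div_nonneg (sq_nonneg _) (qpos k ω).le
  let ent : ℕ → ℝ := fun k => ∫ ω, q k ω * Real.log (q k ω) ∂P
  have ent0 : ent 0 = 0 := by simp [ent, q]
  have estep : ∀ k, e k ≤ 2 * (ent (k + 1) - ent k) := fun k =>
    integral_sq_posPart_sub_div_le (strictPast_le hZ k) (bq k) (bqΩ (k + 1)) hlo (qlo k)
      (qlo (k + 1)) (qstep k)
  -- The increment inequality, applied from `q k` directly to `D`, shows that conditioning does not
  -- raise entropy.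
  have elast : ∀ k, ent k ≤ ∫ ω, D ω * Real.log (D ω) ∂P := fun k => by
    have h1 := integral_sq_posPart_sub_div_le (strictPast_le hZ k) (bq k) bD hlo (qlo k) hDlo (qD k)
    have h2 : 0 ≤ ∫ ω, (max (q k ω - D ω) 0) ^ 2 / q k ω ∂P :=
      integral_nonneg fun ω => div_nonneg (sq_nonneg _) (qpos k ω).le
    have : ent k = ∫ ω, q k ω * Real.log (q k ω) ∂P := rfl
    linarith
  have esum : ∑ k ∈ Finset.range T, e k ≤ 2 * ∫ ω, D ω * Real.log (D ω) ∂P := by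
    calc ∑ k ∈ Finset.range T, e k ≤ ∑ k ∈ Finset.range T, 2 * (ent (k + 1) - ent k) :=
          Finset.sum_le_sum fun k _ => estep k
      _ = 2 * ent T := by rw [← Finset.mul_sum, Finset.sum_range_sub, ent0, sub_zero]
      _ ≤ _ := by linarith [elast T]
  refine ⟨ent0 ▸ elast 0, ?_⟩
  have perj : ∀ j, j < T → ∫ ω, G j ω * (1 - D ω) ∂P ≤ Real.sqrt (∫ ω, G j ω ^ 2 ∂P) *
      ∑ k ∈ Finset.range (j + 1),
        (if k < j then Real.sqrt (2 * mixingCoeff P Z T k j) else 1) * Real.sqrt (e k) := by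
    intro j hj
    have hcm := (hZ j).comap_le
    choose w' wm w0 w1 hw' using fun k =>
      exists_condExp_version (P := P) (hZ j).comap_le (bqΩ k).1 (qlo k) (qhi k)
    -- `w k` is the density of the law of `Z j` under the measure with density `q k`. It
    -- interpolates from 1 to the tilted marginal, reached at `k = j + 1`.
    let w : ℕ → Ω → ℝ := fun k => Nat.casesOn k (fun _ => 1) fun k => w' (k + 1)
    have wlo : ∀ k ω, lo ≤ w k ω := fun k ω => by
      cases k with
      | zero => exact hlo1
      | succ k => exact w0 _ ω
    have bw : ∀ k, IsBddMeas (MeasurableSpace.comap (Z j) inferInstance) (w k) := fun k => by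
      cases k with
      | zero => exact isBddMeas_const _ 1
      | succ k => exact isBddMeas_of_mem_Icc (wm _) (w0 _) (w1 _)
    have hw : ∀ k, ∀ u : Ω → ℝ, IsBddMeas (MeasurableSpace.comap (Z j) inferInstance) u →
        ∫ ω, q k ω * u ω ∂P = ∫ ω, w k ω * u ω ∂P := fun k u hu => by
      cases k with
      | zero => rfl
      | succ k => exact hw' (k + 1) u hu.1 hu.2
    have bwΩ : ∀ k, IsBddMeas mΩ (w k) := fun k => (bw k).mono hcm
    have wpos : ∀ k ω, 0 < w k ω := fun k ω => hlo.trans_le (wlo k ω)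
    have hGD : ∫ ω, G j ω * (1 - D ω) ∂P = ∫ ω, G j ω * (1 - w (j + 1) ω) ∂P := by
      have c1 := hw (j + 1) _ (hG j)
      have c2 := qD (j + 1) _ ((hG j).mono (comap_le_pastSigma Z le_rfl))
      have bG := (hG j).mono hcm
      have r : ∀ f : Ω → ℝ, IsBddMeas mΩ f →
          ∫ ω, G j ω * (1 - f ω) ∂P = ∫ ω, G j ω ∂P - ∫ ω, f ω * G j ω ∂P := fun f hf => by
        rw [← integral_sub bG.integrable (hf.mul bG).integrable]
        exact integral_congr_ae (Filter.Eventually.of_forall fun ω => by dsimp only; ring)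
      rw [r D bD, r (w (j + 1)) (bwΩ (j + 1)), c2, c1]
    rw [hGD]
    refine (integral_mul_one_sub_le_sum ((hG j).mono hcm) (hG0 j) bwΩ hlo wlo (fun _ => rfl)
      (j + 1)).trans (mul_le_mul_of_nonneg_left (Finset.sum_le_sum fun k hk => ?_)
        (Real.sqrt_nonneg _))
    have hkj : k ≤ j := Nat.lt_succ_iff.1 (Finset.mem_range.1 hk)
    let h : Ω → ℝ := fun ω => max (1 - w (k + 1) ω / w k ω) 0
    have bh : IsBddMeas (MeasurableSpace.comap (Z j) inferInstance) h :=
      ((isBddMeas_const _ 1).sub ((bw (k + 1)).div (bw k) hlo (wlo k))).posPart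
    have h0 : ∀ ω, 0 ≤ h ω := fun ω => le_max_right _ _
    have h1 : ∀ ω, h ω ≤ 1 := fun ω =>
      max_le (by linarith [div_pos (wpos (k + 1) ω) (wpos k ω)]) zero_le_one
    have bhΩ := bh.mono hcm
    -- Where `h` is nonzero, `w k * h = w k - w (k + 1)`. As `h` depends on `Z j` only, the `w`'s
    -- may then be exchanged for the `q`'s.
    have main : ∫ ω, w k ω * (max (1 - w (k + 1) ω / w k ω) 0) ^ 2 ∂P =
        ∫ ω, (2 * h ω * (q k ω - q (k + 1) ω) - h ω ^ 2 * q k ω) ∂P := by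
      have c1 := hw k _ bh
      have c2 := hw (k + 1) _ bh
      have c3 := hw k _ bh.sq
      have r : ∀ f g : Ω → ℝ, IsBddMeas mΩ f → IsBddMeas mΩ g →
          ∫ ω, (2 * h ω * (f ω - g ω) - h ω ^ 2 * f ω) ∂P =
          2 * ∫ ω, f ω * h ω ∂P - 2 * ∫ ω, g ω * h ω ∂P - ∫ ω, f ω * h ω ^ 2 ∂P := by
        intro f g hf hg
        have i1 := (hf.mul bhΩ).const_mul 2
        have i2 := (hg.mul bhΩ).const_mul 2
        rw [← integral_const_mul, ← integral_const_mul, ← integral_sub i1.integrable i2.integrable,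
          ← integral_sub (i1.sub i2).integrable (hf.mul bhΩ.sq).integrable]
        exact integral_congr_ae (Filter.Eventually.of_forall fun ω => by dsimp only; ring)
      rw [r _ _ (bqΩ k) (bqΩ (k + 1)), c1, c2, c3, ← r _ _ (bwΩ k) (bwΩ (k + 1))]
      refine integral_congr_ae (Filter.Eventually.of_forall fun ω => ?_)
      dsimp only
      have hp := wpos k ω
      change w k ω * h ω ^ 2 = _
      rcases le_total (w (k + 1) ω / w k ω) 1 with hle | hle
      · have : h ω = 1 - w (k + 1) ω / w k ω := max_eq_left (by linarith)
        have e : w k ω - w (k + 1) ω = w k ω * h ω := by rw [this]; field_simp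
        rw [e]; ring
      · have : h ω = 0 := max_eq_right (by linarith)
        rw [this]; ring
    rw [main]
    -- For `k < j` the influence bound applies; `k = j` is the diagonal.
    split_ifs with hlt
    · rw [← Real.sqrt_mul (by have := mixingCoeff_nonneg P Z T k j; positivity)]
      refine Real.sqrt_le_sqrt ?_
      exact integral_two_mul_sub_sq_le_mixingCoeff hZ hj ((bq k).mono (strictPast_le_pastSigma Z k))
        (bq (k + 1)) (qpos k) (bquot k) (by rw [qint k, qint (k + 1)]) bh.1 h0 h1
    · rw [one_mul]
      refine Real.sqrt_le_sqrt (integral_mono ?_ (bquot k).integrable fun ω =>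
        two_mul_sub_sq_le (qpos k ω) (h0 ω))
      exact (((bhΩ.const_mul 2).mul ((bqΩ k).sub (bqΩ (k + 1)))).sub
        (bhΩ.sq.mul (bqΩ k))).integrable
  let v : ℕ → ℝ := fun j => Real.sqrt (∫ ω, G j ω ^ 2 ∂P)
  have reorder : ∑ j ∈ Finset.range T, v j * ∑ k ∈ Finset.range (j + 1),
        (if k < j then Real.sqrt (2 * mixingCoeff P Z T k j) else 1) * Real.sqrt (e k) =
      ∑ k : Fin T, Real.sqrt (e k) * ∑ j : Fin T, dependencyMatrix P Z T k j * v j := by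
    have r1 : ∀ j ∈ Finset.range T, v j * ∑ k ∈ Finset.range (j + 1),
        (if k < j then Real.sqrt (2 * mixingCoeff P Z T k j) else 1) * Real.sqrt (e k) =
        ∑ k ∈ Finset.range T, Real.sqrt (e k) * ((if k < j then Real.sqrt (2 * mixingCoeff P Z T k j)
          else if k = j then 1 else 0) * v j) := by
      intro j hj
      have hj' := Finset.mem_range.1 hj
      rw [Finset.mul_sum]
      have hsub : Finset.range (j + 1) ⊆ Finset.range T := Finset.range_subset_range.2 hj'
      rw [← Finset.sum_subset hsub]
      · refine Finset.sum_congr rfl fun k hk => ?_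
        have hk' := Finset.mem_range.1 hk
        by_cases hlt : k < j
        · rw [if_pos hlt, if_pos hlt]; ring
        · rw [if_neg hlt, if_neg hlt, if_pos (by omega)]; ring
      · intro k _ hk
        rw [Finset.mem_range] at hk
        rw [if_neg (by omega), if_neg (by omega)]; ring
    rw [Finset.sum_congr rfl r1, Finset.sum_comm, Finset.sum_range]
    refine Finset.sum_congr rfl fun k _ => ?_
    rw [Finset.sum_range, Finset.mul_sum]
    refine Finset.sum_congr rfl fun j _ => ?_
    simp only [dependencyMatrix, Matrix.of_apply, Fin.lt_def, Fin.ext_iff]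
  calc ∑ j ∈ Finset.range T, ∫ ω, G j ω * (1 - D ω) ∂P
      ≤ ∑ j ∈ Finset.range T, v j * ∑ k ∈ Finset.range (j + 1),
        (if k < j then Real.sqrt (2 * mixingCoeff P Z T k j) else 1) * Real.sqrt (e k) :=
        Finset.sum_le_sum fun j hj => perj j (Finset.mem_range.1 hj)
    _ = _ := reorder
    _ ≤ _ := sum_mul_mulVec_le (dependencyMatrix P Z T) (fun k => Real.sqrt (e k)) (fun j => v j)
    _ = Real.sqrt (∑ k ∈ Finset.range T, e k) * (matrixOpNorm (dependencyMatrix P Z T) *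
        Real.sqrt (∑ j ∈ Finset.range T, ∫ ω, G j ω ^ 2 ∂P)) := by
      rw [Finset.sum_range, Finset.sum_range]
      simp only [v, Real.sq_sqrt (e0 _), Real.sq_sqrt (integral_nonneg fun ω => sq_nonneg (G _ ω))]
    _ ≤ Real.sqrt (2 * ∫ ω, D ω * Real.log (D ω) ∂P) * (matrixOpNorm (dependencyMatrix P Z T) *
        Real.sqrt (∑ j ∈ Finset.range T, ∫ ω, G j ω ^ 2 ∂P)) :=
      mul_le_mul_of_nonneg_right (Real.sqrt_le_sqrt esum)
        (mul_nonneg (matrixOpNorm_nonneg _) (Real.sqrt_nonneg _))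
    _ = _ := by ring

/-- A one-sided Bernstein bound for the Laplace transform of a sum of nonnegative functions of
dependent observations. -/
theorem integral_exp_neg_sum_le {P : Measure Ω} [IsProbabilityMeasure P] {Z : ℕ → Ω → S}
    (hZ : ∀ t, Measurable (Z t)) (T : ℕ) {G : ℕ → Ω → ℝ} {M : ℝ}
    (hG : ∀ j, Measurable[MeasurableSpace.comap (Z j) inferInstance] (G j))
    (hG0 : ∀ j ω, 0 ≤ G j ω) (hGM : ∀ j ω, G j ω ≤ M) {l : ℝ} (hl : 0 ≤ l) :
    ∫ ω, Real.exp (-(l * ∑ j ∈ Finset.range T, G j ω)) ∂P ≤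
      Real.exp (-(l * ∑ j ∈ Finset.range T, ∫ ω, G j ω ∂P) + l ^ 2 *
        matrixOpNorm (dependencyMatrix P Z T) ^ 2 *
          (∑ j ∈ Finset.range T, ∫ ω, G j ω ^ 2 ∂P) / 2) := by
  set L := matrixOpNorm (dependencyMatrix P Z T)
  set V := ∑ j ∈ Finset.range T, ∫ ω, G j ω ^ 2 ∂P
  have bG : ∀ j, IsBddMeas (MeasurableSpace.comap (Z j) inferInstance) (G j) := fun j =>
    isBddMeas_of_mem_Icc (hG j) (hG0 j) (hGM j)
  have bGΩ : ∀ j, IsBddMeas mΩ (G j) := fun j => (bG j).mono (hZ j).comap_le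
  let S' : Ω → ℝ := fun ω => ∑ j ∈ Finset.range T, G j ω
  have S0 : ∀ ω, 0 ≤ S' ω := fun ω => Finset.sum_nonneg fun j _ => hG0 j ω
  have S1 : ∀ ω, S' ω ≤ T * M := fun ω => by
    refine (Finset.sum_le_sum fun j _ => hGM j ω).trans ?_
    rw [Finset.sum_const, Finset.card_range, nsmul_eq_mul]
  have Sm : Measurable S' := Finset.measurable_sum _ fun j _ => (bGΩ j).1
  have bS : IsBddMeas mΩ S' := isBddMeas_of_mem_Icc Sm S0 S1
  let E : Ω → ℝ := fun ω => Real.exp (-(l * S' ω))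
  have Em : Measurable E := (Sm.const_mul l).neg.exp
  have E0 : ∀ ω, Real.exp (-(l * (T * M))) ≤ E ω := fun ω =>
    Real.exp_le_exp.2 (neg_le_neg (mul_le_mul_of_nonneg_left (S1 ω) hl))
  have E1 : ∀ ω, E ω ≤ 1 := fun ω => Real.exp_le_one_iff.2 (neg_nonpos.2 (mul_nonneg hl (S0 ω)))
  have bE : IsBddMeas mΩ E := isBddMeas_of_mem_Icc Em E0 E1
  let z : ℝ := ∫ ω, E ω ∂P
  have z0 : Real.exp (-(l * (T * M))) ≤ z := by
    have := integral_mono (μ := P) (integrable_const _) bE.integrable E0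
    simpa using this
  have z1 : z ≤ 1 := by
    have := integral_mono (μ := P) bE.integrable (integrable_const _) E1
    simpa using this
  have zpos : 0 < z := (Real.exp_pos _).trans_le z0
  -- The Gibbs tilt: its entropy is `-l ∫ D S' - log z`, so a bound on the shift of the mean becomes
  -- a bound on `log z`. Boundedness of `S'` keeps `D` away from 0.
  let D : Ω → ℝ := fun ω => E ω / z
  have Dm : Measurable D := Em.div_const z
  have D1 : ∫ ω, D ω ∂P = 1 := by
    rw [integral_div]; exact div_self zpos.ne'
  have bD : IsBddMeas mΩ D := bE.div (isBddMeas_const _ z) zpos fun _ => le_rfl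
  obtain ⟨h1, h2⟩ := sum_integral_mul_one_sub_le hZ T bG hG0 Dm
    (div_pos (Real.exp_pos _) zpos) ((div_le_one zpos).2 z0) ((one_le_div zpos).2 z1)
    (fun ω => div_le_div_of_nonneg_right (E0 ω) zpos.le)
    (fun ω => div_le_div_of_nonneg_right (E1 ω) zpos.le) D1
  have sum1 : ∑ j ∈ Finset.range T, ∫ ω, G j ω * (1 - D ω) ∂P =
      ∑ j ∈ Finset.range T, ∫ ω, G j ω ∂P - ∫ ω, D ω * S' ω ∂P := by
    have e1 : ∑ j ∈ Finset.range T, ∫ ω, G j ω ∂P = ∫ ω, S' ω ∂P :=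
      (integral_finsetSum _ fun j _ => (bGΩ j).integrable).symm
    rw [e1, ← integral_sub bS.integrable (bD.mul bS).integrable,
      ← integral_finsetSum _ fun j _ => ((bGΩ j).mul ((isBddMeas_const _ 1).sub bD)).integrable]
    refine integral_congr_ae (Filter.Eventually.of_forall fun ω => ?_)
    dsimp only
    rw [← Finset.sum_mul]; ring
  have ent : ∫ ω, D ω * Real.log (D ω) ∂P = -(l * ∫ ω, D ω * S' ω ∂P) - Real.log z := by
    have hlog : ∀ ω, D ω * Real.log (D ω) = -(l * (D ω * S' ω)) - D ω * Real.log z := fun ω => by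
      simp only [D, E]
      rw [Real.log_div (Real.exp_pos _).ne' zpos.ne', Real.log_exp]
      ring
    have i1 : Integrable (fun ω => -(l * (D ω * S' ω))) P :=
      ((bD.mul bS).const_mul l).integrable.neg
    rw [integral_congr_ae (Filter.Eventually.of_forall hlog),
      integral_sub i1 (bD.mul (isBddMeas_const _ _)).integrable, integral_neg, integral_const_mul,
      integral_mul_const, D1, one_mul]
  rw [sum1] at h2
  change z ≤ _
  rw [← Real.log_le_iff_le_exp zpos]
  set H := ∫ ω, D ω * Real.log (D ω) ∂P
  have hV : 0 ≤ V := Finset.sum_nonneg fun j _ => integral_nonneg fun ω => sq_nonneg _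
  have hs := Real.sq_sqrt hV
  have hy := Real.sq_sqrt (by linarith : 0 ≤ 2 * H)
  have h3 := mul_le_mul_of_nonneg_left h2 hl
  have h4 : l ^ 2 * L ^ 2 * V = (l * L * Real.sqrt V) ^ 2 := by rw [mul_pow, mul_pow, hs]
  rw [h4]
  -- The term `l L √V √(2H) - H` is at most `l² L² V / 2`, by completing the square.
  nlinarith [sq_nonneg (l * L * Real.sqrt V - Real.sqrt (2 * H))]

/-- The lower tail of a sum of nonnegative functions of dependent observations. -/
theorem measureReal_sum_le_half_le {P : Measure Ω} [IsProbabilityMeasure P] {Z : ℕ → Ω → S}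
    (hZ : ∀ t, Measurable (Z t)) {T : ℕ} {G : ℕ → Ω → ℝ} {M : ℝ} (hM : 0 < M)
    (hG : ∀ j, Measurable[MeasurableSpace.comap (Z j) inferInstance] (G j))
    (hG0 : ∀ j ω, 0 ≤ G j ω) (hGM : ∀ j ω, G j ω ≤ M)
    (hL : 0 < matrixOpNorm (dependencyMatrix P Z T)) :
    P.real {ω | ∑ j ∈ Finset.range T, G j ω ≤ (∑ j ∈ Finset.range T, ∫ ω, G j ω ∂P) / 2} ≤
      Real.exp (-((∑ j ∈ Finset.range T, ∫ ω, G j ω ∂P) /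
        (8 * M * matrixOpNorm (dependencyMatrix P Z T) ^ 2))) := by
  set L := matrixOpNorm (dependencyMatrix P Z T) with hLdef
  set s := ∑ j ∈ Finset.range T, ∫ ω, G j ω ∂P with hs
  have bG : ∀ j, IsBddMeas mΩ (G j) := fun j =>
    (isBddMeas_of_mem_Icc (hG j) (hG0 j) (hGM j)).mono (hZ j).comap_le
  -- The minimizer of `-l s / 2 + l² L² M s / 2`, the Chernoff exponent once the second moments are
  -- bounded by `M s`.
  set l : ℝ := 1 / (2 * L ^ 2 * M) with hl
  have hlpos : 0 < l := by positivity
  have hV : ∑ j ∈ Finset.range T, ∫ ω, G j ω ^ 2 ∂P ≤ M * s := by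
    rw [hs, Finset.mul_sum]
    refine Finset.sum_le_sum fun j _ => ?_
    rw [← integral_const_mul]
    refine integral_mono (bG j).sq.integrable ((bG j).const_mul M).integrable fun ω => ?_
    dsimp only
    rw [pow_two]
    exact mul_le_mul_of_nonneg_right (hGM j ω) (hG0 j ω)
  have hlap := integral_exp_neg_sum_le (P := P) hZ T hG hG0 hGM hlpos.le
  have hmeas : Measurable fun ω => ∑ j ∈ Finset.range T, G j ω :=
    Finset.measurable_sum _ fun j _ => (bG j).1
  have hint : Integrable (fun ω => Real.exp (-(l * ∑ j ∈ Finset.range T, G j ω))) P := by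
    refine (isBddMeas_of_mem_Icc (lo := 0) (hi := 1) (hmeas.const_mul l).neg.exp
      (fun ω => (Real.exp_pos _).le) fun ω => Real.exp_le_one_iff.2 (neg_nonpos.2
        (mul_nonneg hlpos.le (Finset.sum_nonneg fun j _ => hG0 j ω)))).integrable
  have hmarkov := mul_meas_ge_le_integral_of_nonneg (μ := P)
    (Filter.Eventually.of_forall fun ω => (Real.exp_pos (-(l * ∑ j ∈ Finset.range T, G j ω))).le)
    hint (Real.exp (-(l * (s / 2))))
  have hset : {ω | ∑ j ∈ Finset.range T, G j ω ≤ s / 2} ⊆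
      {ω | Real.exp (-(l * (s / 2))) ≤ Real.exp (-(l * ∑ j ∈ Finset.range T, G j ω))} :=
    fun ω hω => Real.exp_le_exp.2 (neg_le_neg (mul_le_mul_of_nonneg_left hω hlpos.le))
  have h1 := measureReal_mono (μ := P) hset
  have h2 : Real.exp (-(l * (s / 2))) * P.real {ω | ∑ j ∈ Finset.range T, G j ω ≤ s / 2} ≤
      Real.exp (-(l * s) + l ^ 2 * L ^ 2 * (M * s) / 2) := by
    refine (mul_le_mul_of_nonneg_left h1 (Real.exp_pos _).le).trans (hmarkov.trans
      (hlap.trans (Real.exp_le_exp.2 ?_)))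
    have := mul_le_mul_of_nonneg_left hV (by positivity : 0 ≤ l ^ 2 * L ^ 2)
    linarith
  have h3 : -(l * s) + l ^ 2 * L ^ 2 * (M * s) / 2 = -(l * (s / 2)) + -(s / (8 * M * L ^ 2)) := by
    rw [hl]; field_simp; ring
  rw [h3, Real.exp_add] at h2
  exact le_of_mul_le_mul_left h2 (Real.exp_pos _)

end Laplace

/-! ### Covers and the lower isometry. -/

section Class

variable {Ω : Type*} [MeasurableSpace Ω] {dx dy : ℕ} {D : Set (Euc dx)}
  {G N : Set (Euc dx → Euc dy)}

theorem norm_le_of_supNorm_le {f : Euc dx → Euc dy} {b : ℝ} (hb : 0 ≤ b)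
    (hf : supNorm D f ≤ ENNReal.ofReal b) {x : Euc dx} (hx : x ∈ D) : ‖f x‖ ≤ b := by
  have h : ‖f x‖ₑ ≤ ENNReal.ofReal b := (le_iSup₂ (f := fun x (_ : x ∈ D) => ‖f x‖ₑ) x hx).trans hf
  rw [← ofReal_norm] at h
  exact (ENNReal.ofReal_le_ofReal_iff hb).1 h

theorem exists_isSupCover_of_entropyBound {p q : ℝ} (hent : EntropyBound D G p q) {ε : ℝ}
    (h0 : 0 < ε) (h1 : ε < 1) : ∃ N : Set (Euc dx → Euc dy), IsSupCover D G N ε ∧ N.Finite ∧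
      (N.ncard : ℝ) ≤ Real.exp (p * (1 / ε) ^ q) := by
  obtain ⟨hfin, hlog⟩ := hent ε h0 h1
  obtain ⟨c, hc⟩ := ENat.ne_top_iff_exists.1 hfin
  have hex : ∃ N, IsSupCover D G N ε ∧ N.encard < c + 1 := by
    by_contra hcon
    push Not at hcon
    have : ((c : ℕ∞) + 1) ≤ coveringNumber D G ε := le_iInf₂ fun N hN => hcon N hN
    rw [← hc] at this
    exact absurd this (by norm_cast; omega)
  obtain ⟨N, hN, hcard⟩ := hex
  have hNfin : N.Finite := Set.encard_lt_top_iff.1 (hcard.trans_le le_top)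
  refine ⟨N, hN, hNfin, ?_⟩
  have hle : N.ncard ≤ c := by
    rw [← hNfin.cast_ncard_eq] at hcard
    norm_cast at hcard
    omega
  rw [← hc, ENat.toNat_natCast] at hlog
  have hle' : (N.ncard : ℝ) ≤ c := by exact_mod_cast hle
  refine hle'.trans ?_
  -- `Real.log 0 = 0`, so an empty cover is treated apart.
  rcases Nat.eq_zero_or_pos c with rfl | hpos
  · simpa using (Real.exp_pos _).le
  · exact (Real.log_le_iff_le_exp (by exact_mod_cast hpos)).1 hlog

/-- The empirical analogue of `sqL2Norm`. -/
def empSqNorm (X : ℕ → Ω → Euc dx) (T : ℕ) (f : Euc dx → Euc dy) (ω : Ω) : ℝ :=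
  (1 / (T : ℝ)) * ∑ t ∈ Finset.range T, ‖f (X t ω)‖ ^ 2

theorem sqL2Norm_smul (P : Measure Ω) (X : ℕ → Ω → Euc dx) (T : ℕ) (a : ℝ)
    (f : Euc dx → Euc dy) : sqL2Norm P X T (a • f) = a ^ 2 * sqL2Norm P X T f := by
  simp only [sqL2Norm, Pi.smul_apply, norm_smul, mul_pow, integral_const_mul, Real.norm_eq_abs,
    sq_abs, ← Finset.mul_sum]
  ring

theorem sqL2Norm_nonneg (P : Measure Ω) (X : ℕ → Ω → Euc dx) (T : ℕ)
    (f : Euc dx → Euc dy) : 0 ≤ sqL2Norm P X T f :=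
  mul_nonneg (by positivity) (Finset.sum_nonneg fun _ _ => integral_nonneg fun _ => sq_nonneg _)

theorem sqL2Norm_le {P : Measure Ω} [IsProbabilityMeasure P] {X : ℕ → Ω → Euc dx} {T : ℕ}
    (hXD : ∀ t ω, X t ω ∈ D) {f : Euc dx → Euc dy} {b : ℝ} (hT : 1 ≤ T)
    (hf : ∀ x ∈ D, ‖f x‖ ≤ b) : sqL2Norm P X T f ≤ b ^ 2 := by
  have hT' : (0 : ℝ) < T := by exact_mod_cast hT
  have : ∀ t ∈ Finset.range T, ∫ ω, ‖f (X t ω)‖ ^ 2 ∂P ≤ b ^ 2 := fun t _ => by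
    have := integral_mono_of_nonneg (μ := P) (f := fun ω => ‖f (X t ω)‖ ^ 2)
      (g := fun _ => b ^ 2)
      (Filter.Eventually.of_forall fun ω => sq_nonneg _) (integrable_const _)
      (Filter.Eventually.of_forall fun ω =>
        pow_le_pow_left₀ (norm_nonneg _) (hf _ (hXD t ω)) 2)
    simpa using this
  have h2 := Finset.sum_le_sum this
  rw [Finset.sum_const, Finset.card_range, nsmul_eq_mul] at h2
  rw [sqL2Norm, one_div, inv_mul_le_iff₀ hT']
  exact h2

/-- Lower isometry: off an event of small probability, the empirical norm of every element of a
star-shaped class whose population norm is not too small dominates the population norm. -/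
theorem exists_lower_isometry_event {P : Measure Ω} [IsProbabilityMeasure P]
    {X : ℕ → Ω → Euc dx} (hX : ∀ t, Measurable (X t)) (hXD : ∀ t ω, X t ω ∈ D) {T : ℕ}
    (hT : 1 ≤ T) (hGm : ∀ f ∈ G, Measurable f) (hstar : StarShaped G) {b : ℝ} (hb : 0 < b)
    (hbdd : ∀ f ∈ G, ∀ x ∈ D, ‖f x‖ ≤ b) (hN : N.Finite) {ε : ℝ}
    (hcov : ∀ f ∈ G, ∃ g ∈ N, ∀ x ∈ D, ‖f x - g x‖ ≤ ε) {ρ : ℝ} (hρ : 0 < ρ)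
    (hερ : 32 * ε ^ 2 ≤ ρ) (hL : 0 < matrixOpNorm (dependencyMatrix P X T)) :
    ∃ E : Set Ω, MeasurableSet E ∧
      P.real E ≤ N.ncard *
        Real.exp (-(T * ρ / (8 * b ^ 2 * matrixOpNorm (dependencyMatrix P X T) ^ 2))) ∧
      ∀ ω, ω ∉ E → ∀ f ∈ G, ρ ≤ sqL2Norm P X T f →
        sqL2Norm P X T f ≤ 8 * empSqNorm X T f ω := by
  classical
  have hT' : (0 : ℝ) < T := by exact_mod_cast hT
  let near : (Euc dx → Euc dy) → (Euc dx → Euc dy) → Prop := fun g f =>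
    f ∈ G ∧ sqL2Norm P X T f = ρ ∧ ∀ x ∈ D, ‖f x - g x‖ ≤ ε
  let low : (Euc dx → Euc dy) → Set Ω := fun f =>
    {ω | ∑ t ∈ Finset.range T, ‖f (X t ω)‖ ^ 2 ≤ (∑ t ∈ Finset.range T, ∫ ω, ‖f (X t ω)‖ ^ 2 ∂P) / 2}
  -- A centre need not lie on the sphere, so each centre near the sphere is represented by a chosen
  -- function on it. Any function of the sphere close to that centre is within `2 * ε` of the
  -- representative.
  let bad : (Euc dx → Euc dy) → Set Ω := fun g =>
    if h : ∃ f, near g f then low h.choose else ∅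
  have sumEq : ∀ f : Euc dx → Euc dy, sqL2Norm P X T f = ρ →
      ∑ t ∈ Finset.range T, ∫ ω, ‖f (X t ω)‖ ^ 2 ∂P = T * ρ := fun f hf => by
    rw [← hf, sqL2Norm]; field_simp
  have hmeas : ∀ f : Euc dx → Euc dy, Measurable f → ∀ t,
      Measurable[MeasurableSpace.comap (X t) inferInstance] fun ω => ‖f (X t ω)‖ ^ 2 :=
    fun f hf t => (hf.norm.pow_const 2).comp (comap_measurable (X t))
  have badmeas : ∀ g, MeasurableSet (bad g) := fun g => by
    by_cases h : ∃ f, near g f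
    · simp only [bad, dif_pos h, low]
      refine measurableSet_le (Finset.measurable_sum _ fun t _ => ?_) measurable_const
      exact (hmeas _ (hGm _ h.choose_spec.1) t).mono (hX t).comap_le le_rfl
    · simp only [bad, dif_neg h]; exact MeasurableSet.empty
  have badprob : ∀ g, P.real (bad g) ≤
      Real.exp (-(T * ρ / (8 * b ^ 2 * matrixOpNorm (dependencyMatrix P X T) ^ 2))) := fun g => by
    by_cases h : ∃ f, near g f
    · simp only [bad, dif_pos h, low]
      obtain ⟨h1, h2, -⟩ := h.choose_spec
      have := measureReal_sum_le_half_le (P := P) hX (T := T)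
        (G := fun t ω => ‖h.choose (X t ω)‖ ^ 2) (M := b ^ 2) (by positivity)
        (hmeas _ (hGm _ h1)) (fun t ω => sq_nonneg _)
        (fun t ω => pow_le_pow_left₀ (norm_nonneg _) (hbdd _ h1 _ (hXD t ω)) 2) hL
      rw [sumEq _ h2] at this
      rw [sumEq _ h2]
      exact this
    · simp only [bad, dif_neg h, measureReal_empty]; exact (Real.exp_pos _).le
  refine ⟨⋃ g ∈ hN.toFinset, bad g, Finset.measurableSet_biUnion _ fun g _ => badmeas g, ?_, ?_⟩
  · refine (measureReal_biUnion_finset_le _ _).trans ((Finset.sum_le_sum fun g _ => badprob g).trans ?_)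
    rw [Finset.sum_const, nsmul_eq_mul, Set.ncard_eq_toFinset_card N hN]
  · intro ω hω f hf hfρ
    have hpos : 0 < sqL2Norm P X T f := hρ.trans_le hfρ
    -- The scaling that moves `f` onto the sphere; star-shapedness keeps it in the class because `a
    -- ≤ 1`.
    set a : ℝ := Real.sqrt (ρ / sqL2Norm P X T f) with ha
    have ha2 : a ^ 2 = ρ / sqL2Norm P X T f := Real.sq_sqrt (div_pos hρ hpos).le
    have ha0 : 0 ≤ a := Real.sqrt_nonneg _
    have ha1 : a ≤ 1 := Real.sqrt_le_one.2 ((div_le_one hpos).2 hfρ)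
    have hfa := hstar f hf a ha0 ha1
    have hnorm : sqL2Norm P X T (a • f) = ρ := by
      rw [sqL2Norm_smul, ha2, div_mul_cancel₀ _ hpos.ne']
    obtain ⟨g, hgN, hg⟩ := hcov _ hfa
    have hex : ∃ f, near g f := ⟨a • f, hfa, hnorm, hg⟩
    obtain ⟨h1, h2, h3⟩ := hex.choose_spec
    set f' := hex.choose
    have hnot : ω ∉ low f' := fun hcon => hω (by
      simp only [Set.mem_iUnion]
      refine ⟨g, hN.mem_toFinset.2 hgN, ?_⟩
      simp only [bad, dif_pos hex]
      exact hcon)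
    have hlow : (T * ρ) / 2 < ∑ t ∈ Finset.range T, ‖f' (X t ω)‖ ^ 2 := by
      rw [← sumEq f' h2]; exact not_le.1 hnot
    have hterm : ∀ t ∈ Finset.range T,
        ‖f' (X t ω)‖ ^ 2 ≤ 2 * (a ^ 2 * ‖f (X t ω)‖ ^ 2) + ρ / 4 := fun t _ => by
      have e1 := hg _ (hXD t ω)
      have e2 := h3 _ (hXD t ω)
      have e3 : ‖(a • f) (X t ω)‖ = a * ‖f (X t ω)‖ := by
        rw [Pi.smul_apply, norm_smul, Real.norm_of_nonneg ha0]
      have e4 : ‖f' (X t ω)‖ ≤ a * ‖f (X t ω)‖ + 2 * ε := by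
        calc ‖f' (X t ω)‖ = ‖(a • f) (X t ω) + ((f' (X t ω) - g (X t ω)) -
              ((a • f) (X t ω) - g (X t ω)))‖ := by congr 1; abel
          _ ≤ ‖(a • f) (X t ω)‖ + (‖f' (X t ω) - g (X t ω)‖ + ‖(a • f) (X t ω) - g (X t ω)‖) :=
              (norm_add_le _ _).trans (add_le_add_right (norm_sub_le _ _) _)
          _ ≤ _ := by rw [e3]; linarith
      have e5 := pow_le_pow_left₀ (norm_nonneg _) e4 2
      -- `(u + 2ε)² ≤ 2u² + 8ε²`, and `8ε² ≤ ρ / 4` by `hερ`. Of the lower bound `Tρ / 2` a quarter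
      -- of `Tρ` survives, and halving it gives the constant 8.
      nlinarith [sq_nonneg (a * ‖f (X t ω)‖ - 2 * ε)]
    have hsum := Finset.sum_le_sum hterm
    rw [Finset.sum_add_distrib, Finset.sum_const, Finset.card_range, nsmul_eq_mul,
      ← Finset.mul_sum, ← Finset.mul_sum] at hsum
    have hfin : T * ρ / 8 ≤ a ^ 2 * ∑ t ∈ Finset.range T, ‖f (X t ω)‖ ^ 2 := by linarith
    rw [ha2, div_mul_eq_mul_div, le_div_iff₀ hpos] at hfin
    rw [empSqNorm]
    have hc : ρ * T * sqL2Norm P X T f ≤ ρ * (8 * ∑ t ∈ Finset.range T, ‖f (X t ω)‖ ^ 2) := by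
      linarith
    rw [mul_assoc] at hc
    have hc' := le_of_mul_le_mul_left hc hρ
    rw [one_div, ← mul_assoc, mul_comm (8 : ℝ), mul_assoc, le_inv_mul_iff₀ hT']
    exact hc'

end Class

/-! ### The offset process, its supremum, and the basic inequality. -/

section Offset

variable {Ω : Type*} {dx dy : ℕ} {D : Set (Euc dx)}
  {G : Set (Euc dx → Euc dy)} {X : ℕ → Ω → Euc dx} {W : ℕ → Ω → Euc dy} {T : ℕ} {b : ℝ}

/-- The offset process whose supremum is `offsetComplexity`. -/
def offsetProcess (X : ℕ → Ω → Euc dx) (W : ℕ → Ω → Euc dy) (T : ℕ)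
    (f : Euc dx → Euc dy) (ω : Ω) : ℝ :=
  (1 / (T : ℝ)) * ∑ t ∈ Finset.range T, (4 * inner ℝ (W t ω) (f (X t ω)) - ‖f (X t ω)‖ ^ 2)

theorem offsetProcess_le (hXD : ∀ t ω, X t ω ∈ D) {f : Euc dx → Euc dy}
    (hf : ∀ x ∈ D, ‖f x‖ ≤ b) (ω : Ω) :
    offsetProcess X W T f ω ≤ (1 / (T : ℝ)) * ∑ t ∈ Finset.range T, 4 * b * ‖W t ω‖ := by
  refine mul_le_mul_of_nonneg_left (Finset.sum_le_sum fun t _ => ?_) (by positivity)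
  have h1 := real_inner_le_norm (W t ω) (f (X t ω))
  have h2 := mul_le_mul_of_nonneg_left (hf _ (hXD t ω)) (norm_nonneg (W t ω))
  nlinarith [sq_nonneg ‖f (X t ω)‖]

theorem bddAbove_offsetProcess (hXD : ∀ t ω, X t ω ∈ D) (hbdd : ∀ f ∈ G, ∀ x ∈ D, ‖f x‖ ≤ b)
    (ω : Ω) : BddAbove (Set.range fun f : G => offsetProcess X W T f.1 ω) :=
  ⟨_, by rintro _ ⟨f, rfl⟩; exact offsetProcess_le hXD (hbdd f.1 f.2) ω⟩

theorem offsetProcess_le_offsetComplexity (hXD : ∀ t ω, X t ω ∈ D)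
    (hbdd : ∀ f ∈ G, ∀ x ∈ D, ‖f x‖ ≤ b) {f : Euc dx → Euc dy} (hf : f ∈ G) (ω : Ω) :
    offsetProcess X W T f ω ≤ offsetComplexity X W T G ω :=
  le_ciSup (bddAbove_offsetProcess hXD hbdd ω) (⟨f, hf⟩ : G)

theorem offsetComplexity_nonneg (hXD : ∀ t ω, X t ω ∈ D)
    (hbdd : ∀ f ∈ G, ∀ x ∈ D, ‖f x‖ ≤ b) (h0 : 0 ∈ G) (ω : Ω) :
    0 ≤ offsetComplexity X W T G ω := by
  have := offsetProcess_le_offsetComplexity (W := W) (T := T) hXD hbdd h0 ω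
  simpa [offsetProcess] using this

/-- Lipschitz continuity in the supremum norm, with a random constant independent of the functions;
it reduces the supremum to a countable one. -/
theorem offsetProcess_sub_le (hXD : ∀ t ω, X t ω ∈ D) {f g : Euc dx → Euc dy}
    (hf : ∀ x ∈ D, ‖f x‖ ≤ b) (hg : ∀ x ∈ D, ‖g x‖ ≤ b) {ε : ℝ}
    (hfg : ∀ x ∈ D, ‖f x - g x‖ ≤ ε) (ω : Ω) :
    offsetProcess X W T f ω - offsetProcess X W T g ω ≤
      ((1 / (T : ℝ)) * ∑ t ∈ Finset.range T, (4 * ‖W t ω‖ + 2 * b)) * ε := by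
  rw [offsetProcess, offsetProcess, ← mul_sub, ← Finset.sum_sub_distrib, mul_assoc, Finset.sum_mul]
  refine mul_le_mul_of_nonneg_left (Finset.sum_le_sum fun t _ => ?_) (by positivity)
  have e1 := hfg _ (hXD t ω)
  have e2 := hf _ (hXD t ω)
  have e3 := hg _ (hXD t ω)
  have h1 := real_inner_le_norm (W t ω) (f (X t ω) - g (X t ω))
  rw [inner_sub_right] at h1
  have h2 := mul_le_mul_of_nonneg_left e1 (norm_nonneg (W t ω))
  have h3 : ‖g (X t ω)‖ - ‖f (X t ω)‖ ≤ ε := by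
    have := norm_sub_norm_le (g (X t ω)) (f (X t ω))
    rw [norm_sub_rev] at this
    linarith
  have h4 : ‖g (X t ω)‖ ^ 2 - ‖f (X t ω)‖ ^ 2 ≤ 2 * b * ε := by
    have hε : 0 ≤ ε := (norm_nonneg _).trans e1
    have n1 := norm_nonneg (f (X t ω))
    have n2 := norm_nonneg (g (X t ω))
    calc ‖g (X t ω)‖ ^ 2 - ‖f (X t ω)‖ ^ 2
        = (‖g (X t ω)‖ + ‖f (X t ω)‖) * (‖g (X t ω)‖ - ‖f (X t ω)‖) := by ring
      _ ≤ (‖g (X t ω)‖ + ‖f (X t ω)‖) * ε := mul_le_mul_of_nonneg_left h3 (by positivity)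
      _ ≤ 2 * b * ε := mul_le_mul_of_nonneg_right (by linarith) hε
  nlinarith

/-- The union of finite covers at scales tending to 0 is countable and dense in the supremum norm
over `D`, so it yields the same supremum. -/
theorem measurable_offsetComplexity [MeasurableSpace Ω] (hX : ∀ t, Measurable (X t)) (hW : ∀ t, Measurable (W t))
    (hXD : ∀ t ω, X t ω ∈ D) (hGm : ∀ f ∈ G, Measurable f) (h0 : 0 ∈ G)
    (hbdd : ∀ f ∈ G, ∀ x ∈ D, ‖f x‖ ≤ b)
    (hcov : ∀ ε : ℝ, 0 < ε → ε < 1 → ∃ N : Set (Euc dx → Euc dy), N ⊆ G ∧ N.Finite ∧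
      ∀ f ∈ G, ∃ g ∈ N, ∀ x ∈ D, ‖f x - g x‖ ≤ ε) :
    Measurable (offsetComplexity X W T G) := by
  -- The shift by 2 keeps every scale strictly below 1, where covers are available.
  have hε : ∀ n : ℕ, (0 : ℝ) < 1 / ((n : ℝ) + 2) ∧ 1 / ((n : ℝ) + 2) < 1 := fun n => by
    have hn : (0 : ℝ) ≤ n := n.cast_nonneg
    exact ⟨by positivity, by rw [div_lt_one (by positivity)]; linarith⟩
  choose N hNG hNfin hNcov using fun n : ℕ => hcov _ (hε n).1 (hε n).2
  let C : Set (Euc dx → Euc dy) := ⋃ n, N n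
  have hC : C.Countable := Set.countable_iUnion fun n => (hNfin n).countable
  have hCG : C ⊆ G := Set.iUnion_subset hNG
  have : Countable C := hC.to_subtype
  have hCne : Nonempty C := by
    obtain ⟨g, hg, -⟩ := hNcov 0 0 h0
    exact ⟨g, Set.mem_iUnion.2 ⟨0, hg⟩⟩
  have hGne : Nonempty G := ⟨0, h0⟩
  have hbC : ∀ ω, BddAbove (Set.range fun f : C => offsetProcess X W T f.1 ω) := fun ω =>
    ⟨_, by rintro _ ⟨f, rfl⟩; exact offsetProcess_le hXD (hbdd f.1 (hCG f.2)) ω⟩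
  have heq : offsetComplexity X W T G = fun ω => ⨆ f : C, offsetProcess X W T f.1 ω := by
    funext ω
    refine le_antisymm (ciSup_le fun f => ?_) (ciSup_le fun f =>
      offsetProcess_le_offsetComplexity hXD hbdd (hCG f.2) ω)
    change offsetProcess X W T f.1 ω ≤ _
    set K := (1 / (T : ℝ)) * ∑ t ∈ Finset.range T, (4 * ‖W t ω‖ + 2 * b)
    have hlim : Filter.Tendsto (fun n : ℕ => (⨆ f : C, offsetProcess X W T f.1 ω) +
        K * (1 / ((n : ℝ) + 2))) Filter.atTop
        (nhds ((⨆ f : C, offsetProcess X W T f.1 ω) + K * 0)) := by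
      refine tendsto_const_nhds.add (Filter.Tendsto.const_mul K ?_)
      have := (Filter.tendsto_add_atTop_iff_nat 1).2
        (tendsto_one_div_add_atTop_nhds_zero_nat (𝕜 := ℝ))
      refine this.congr fun n => ?_
      push_cast
      ring
    rw [mul_zero, add_zero] at hlim
    refine ge_of_tendsto' hlim fun n => ?_
    obtain ⟨g, hg, hfg⟩ := hNcov n f.1 f.2
    have h1 := offsetProcess_sub_le (W := W) (T := T) hXD (hbdd f.1 f.2)
      (hbdd g (hNG n hg)) hfg ω
    have h2 := le_ciSup (hbC ω) (⟨g, Set.mem_iUnion.2 ⟨n, hg⟩⟩ : C)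
    dsimp only at h2
    linarith
  rw [heq]
  refine Measurable.iSup fun f => ?_
  have hf := hGm f.1 (hCG f.2)
  refine (Finset.measurable_sum _ fun t _ => ?_).const_mul _
  exact (((hW t).inner (hf.comp (hX t))).const_mul 4).sub ((hf.comp (hX t)).norm.pow_const 2)

theorem integrable_offsetComplexity [MeasurableSpace Ω] {P : Measure Ω} [IsProbabilityMeasure P]
    (hmeas : Measurable (offsetComplexity X W T G)) (hWi : ∀ t, Integrable (W t) P)
    (hXD : ∀ t ω, X t ω ∈ D) (h0 : 0 ∈ G) (hbdd : ∀ f ∈ G, ∀ x ∈ D, ‖f x‖ ≤ b) :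
    Integrable (offsetComplexity X W T G) P := by
  have hi : Integrable (fun ω => (1 / (T : ℝ)) * ∑ t ∈ Finset.range T, 4 * b * ‖W t ω‖) P :=
    (integrable_finsetSum _ fun t _ => (hWi t).norm.const_mul _).const_mul _
  refine hi.mono' hmeas.aestronglyMeasurable (Filter.Eventually.of_forall fun ω => ?_)
  rw [Real.norm_of_nonneg (offsetComplexity_nonneg hXD hbdd h0 ω)]
  have : Nonempty G := ⟨0, h0⟩
  exact ciSup_le fun f => offsetProcess_le hXD (hbdd f.1 f.2) ω

/-- The basic inequality of least squares. -/
theorem empSqNorm_le_offsetProcess {Y : ℕ → Ω → Euc dy} {fstar f : Euc dx → Euc dy}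
    (hY : ∀ t ω, Y t ω = fstar (X t ω) + W t ω) {ω : Ω}
    (hf : empiricalLoss X Y T f ω ≤ empiricalLoss X Y T fstar ω) :
    empSqNorm X T (f - fstar) ω ≤ offsetProcess X W T (f - fstar) ω := by
  -- Expanding the squares, twice the loss difference produces `4⟨W, h⟩ - 2‖h‖²`; one copy of `‖h‖²`
  -- stays in the offset and the other is the empirical norm.
  have key : offsetProcess X W T (f - fstar) ω - empSqNorm X T (f - fstar) ω =
      2 * (empiricalLoss X Y T fstar ω - empiricalLoss X Y T f ω) := by
    rw [offsetProcess, empSqNorm, empiricalLoss, empiricalLoss, ← mul_sub, ← mul_sub,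
      ← Finset.sum_sub_distrib, ← Finset.sum_sub_distrib, mul_left_comm]
    congr 1
    rw [Finset.mul_sum]
    refine Finset.sum_congr rfl fun t _ => ?_
    have e1 : Y t ω - fstar (X t ω) = W t ω := by rw [hY]; abel
    have e2 : Y t ω - f (X t ω) = W t ω - (f - fstar) (X t ω) := by
      rw [hY, Pi.sub_apply]; abel
    rw [e1, e2, norm_sub_sq_real]
    ring
  linarith

end Offset

/-! ### Absorbing the failure probability into the rate. -/

section Rates

/-- Beats a polynomial of degree `v` by an exponential with a constant explicit in `v`: raise `y / v
≤ exp (y / v)` to the power `v`. -/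
theorem rpow_div_le_exp {y v : ℝ} (hy : 0 ≤ y) (hv : 0 < v) : (y / v) ^ v ≤ Real.exp y := by
  have h : y / v ≤ Real.exp (y / v) := by linarith [Real.add_one_le_exp (y / v)]
  refine (Real.rpow_le_rpow (div_nonneg hy hv.le) h hv.le).trans_eq ?_
  rw [← Real.exp_mul, div_mul_cancel₀ _ hv.ne']

theorem two_mul_le_eight_rpow {v : ℝ} (hv : 1 ≤ v) : 2 * v ≤ (8 : ℝ) ^ v := by
  have := one_add_mul_self_le_rpow_one_add (s := 7) (by norm_num) hv
  norm_num at this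
  linarith

theorem eight_le_eight_rpow {v : ℝ} (hv : 1 ≤ v) : (8 : ℝ) ≤ 8 ^ v :=
  Real.self_le_rpow_of_one_le (by norm_num) hv

/-- The entropy at a scale proportional to the critical radius. -/
theorem mul_one_div_sqrt_rpow_le {p q A θ : ℝ} (hp : 0 < p) (hq0 : 0 < q) (hq2 : q < 2)
    (hA : 0 < A) (hθ : 0 < θ) :
    p * (1 / (Real.sqrt (8 * (A * p / θ) ^ (2 / q)) / 8)) ^ q ≤ 8 * (θ / A) := by
  have hx : 0 < A * p / θ := by positivity
  have e1 : 1 / (Real.sqrt (8 * (A * p / θ) ^ (2 / q)) / 8) =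
      (8 * (θ / (A * p)) ^ (2 / q)) ^ (1 / 2 : ℝ) := by
    have hpos : 0 < (A * p / θ) ^ (2 / q) := Real.rpow_pos_of_pos hx _
    rw [← Real.sqrt_eq_rpow, ← inv_div (A * p) θ, Real.inv_rpow hx.le, one_div_div,
      div_eq_iff (Real.sqrt_pos.2 (by positivity)).ne', ← Real.sqrt_mul (by positivity)]
    have : 8 * ((A * p / θ) ^ (2 / q))⁻¹ * (8 * (A * p / θ) ^ (2 / q)) = 8 ^ 2 := by
      field_simp
    rw [this, Real.sqrt_sq (by norm_num)]
  have hy : 0 < θ / (A * p) := by positivity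
  rw [e1, ← Real.rpow_mul (by positivity), Real.mul_rpow (by norm_num) (by positivity),
    ← Real.rpow_mul hy.le]
  have e2 : 2 / q * (1 / 2 * q) = 1 := by field_simp
  rw [e2, Real.rpow_one]
  have e3 : (8 : ℝ) ^ (1 / 2 * q) ≤ 8 := by
    calc (8 : ℝ) ^ (1 / 2 * q) ≤ 8 ^ (1 : ℝ) :=
          Real.rpow_le_rpow_of_exponent_le (by norm_num) (by linarith)
      _ = 8 := Real.rpow_one 8
  have e4 : p * (8 ^ (1 / 2 * q) * (θ / (A * p))) = 8 ^ (1 / 2 * q) * (θ / A) := by field_simp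
  rw [e4]
  exact mul_le_mul_of_nonneg_right e3 (by positivity)

/-- With `x = A p` and `τ = θ / A` the deviation exponent is `8 τ x ^ v`. Since `p ≥ 1/2` makes `x ≥
8 B²`, the entropy uses at most half of it, and the other half beats `B²` together with the power of
`θ`. -/
theorem mul_exp_le_half_of_large {B L p v A θ T n e : ℝ} (hB : 1 ≤ B) (hL : 1 ≤ L)
    (hp : 1 / 2 ≤ p) (hv : 1 ≤ v) (hA : A = 16 * B ^ 2 * L ^ 2) (hθ : 1 ≤ θ)
    (hT : T = θ * θ ^ v) (hn : n ≤ Real.exp e) (he : e ≤ 8 * (θ / A) ∨ e ≤ 4 * p) :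
    B ^ 2 * (n * Real.exp (-(T * (8 * (A * p / θ) ^ v / 2) / (8 * B ^ 2 * L ^ 2)))) ≤
      8 * (A * p / θ) ^ v / 2 := by
  have hB2 : 1 ≤ B ^ 2 := one_le_pow₀ hB
  have hL2 : 1 ≤ L ^ 2 := one_le_pow₀ hL
  have hA0 : 0 < A := by rw [hA]; positivity
  have hp0 : 0 < p := by linarith
  have hθ0 : 0 < θ := by linarith
  have hv0 : 0 < v := by linarith
  set x := A * p with hx
  have hx8 : 8 * B ^ 2 ≤ x := by
    rw [hx, hA]
    nlinarith [mul_le_mul hL2 hp (by norm_num) (by positivity), mul_pos hp0 (by positivity : 0 < L ^ 2)]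
  have hx1 : 1 ≤ x := by linarith
  have hx0 : 0 < x := by linarith
  have hxv : x ≤ x ^ v := Real.self_le_rpow_of_one_le hx1 hv
  set τ := θ / A with hτ
  have hτ0 : 0 < τ := by positivity
  have hθv : 0 < θ ^ v := Real.rpow_pos_of_pos hθ0 v
  have hxv0 : 0 < x ^ v := Real.rpow_pos_of_pos hx0 v
  have hexp : T * (8 * (x / θ) ^ v / 2) / (8 * B ^ 2 * L ^ 2) = 8 * τ * x ^ v := by
    rw [Real.div_rpow hx0.le hθ0.le, hT, hτ, hA]
    field_simp
    norm_num
  have hent : e ≤ 4 * τ * x ^ v := by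
    rcases he with he | he
    · refine he.trans ?_
      nlinarith
    · refine he.trans ?_
      have h1 : τ * x = θ * p := by rw [hτ, hx]; field_simp
      have h2 : τ * x ≤ τ * x ^ v := mul_le_mul_of_nonneg_left hxv hτ0.le
      nlinarith
  have hlog : B ^ 2 / 4 * (θ / x) ^ v ≤ Real.exp (4 * τ * x ^ v) := by
    have h1 : θ / x = τ / p := by rw [hτ, hx]; field_simp
    have h2 : B ^ 2 / 4 ≤ (4 * p * x ^ v / v) ^ v := by
      have h3 : 2 * B ^ 2 ≤ 4 * p * x ^ v / v := by
        rw [le_div_iff₀ hv0]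
        have h4 : (8 * B ^ 2) ^ v ≤ x ^ v := Real.rpow_le_rpow (by positivity) hx8 hv0.le
        rw [Real.mul_rpow (by norm_num) (by positivity)] at h4
        have h5 : B ^ 2 ≤ (B ^ 2) ^ v := Real.self_le_rpow_of_one_le hB2 hv
        have h6 := mul_le_mul (two_mul_le_eight_rpow hv) h5 (by positivity) (by positivity)
        nlinarith
      calc B ^ 2 / 4 ≤ 2 * B ^ 2 := by linarith
        _ ≤ (2 * B ^ 2) ^ v := Real.self_le_rpow_of_one_le (by linarith) hv
        _ ≤ _ := Real.rpow_le_rpow (by positivity) h3 hv0.le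
    calc B ^ 2 / 4 * (θ / x) ^ v ≤ (4 * p * x ^ v / v) ^ v * (τ / p) ^ v := by
          rw [h1]; exact mul_le_mul_of_nonneg_right h2 (by positivity)
      _ = (4 * τ * x ^ v / v) ^ v := by
          rw [← Real.mul_rpow (by positivity) (by positivity)]
          congr 1; field_simp
      _ ≤ _ := rpow_div_le_exp (by positivity) hv0
  rw [hexp]
  calc B ^ 2 * (n * Real.exp (-(8 * τ * x ^ v)))
      ≤ B ^ 2 * (Real.exp (4 * τ * x ^ v) * Real.exp (-(8 * τ * x ^ v))) := by
        gcongr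
        exact hn.trans (Real.exp_le_exp.2 hent)
    _ = B ^ 2 * Real.exp (-(4 * τ * x ^ v)) := by rw [← Real.exp_add]; congr 2; ring
    _ ≤ 8 * (x / θ) ^ v / 2 := by
      rw [Real.exp_neg, ← div_eq_mul_inv, div_le_iff₀ (Real.exp_pos _)]
      have h7 := mul_le_mul_of_nonneg_left hlog (by positivity : 0 ≤ 8 * (x / θ) ^ v / 2)
      refine le_trans (le_of_eq ?_) h7
      rw [Real.div_rpow hx0.le hθ0.le, Real.div_rpow hθ0.le hx0.le]
      field_simp
      norm_num

/-- With `b² = 4 (2p)^v` the factor `(2p)^v` cancels from the exponent and from both sides. Hence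
arbitrarily small `p` causes no loss, and `8 τ` of entropy is covered by `τ * 8 ^ v`. -/
theorem mul_exp_le_half_of_small {B L p v A θ T n : ℝ} (hB : 1 ≤ B) (hL : 1 ≤ L)
    (hp : 0 < p) (hv : 1 ≤ v) (hA : A = 16 * B ^ 2 * L ^ 2) (hθ : 1 ≤ θ)
    (hT : T = θ * θ ^ v) (hn : n ≤ Real.exp (8 * (θ / A))) :
    4 * (2 * p) ^ v * (n * Real.exp (-(T * (8 * (A * p / θ) ^ v / 2) /
      (8 * (4 * (2 * p) ^ v) * L ^ 2)))) ≤ 8 * (A * p / θ) ^ v / 2 := by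
  have hB2 : 1 ≤ B ^ 2 := one_le_pow₀ hB
  have hL2 : 1 ≤ L ^ 2 := one_le_pow₀ hL
  have hA0 : 0 < A := by rw [hA]; positivity
  have hθ0 : 0 < θ := by linarith
  have hv0 : 0 < v := by linarith
  have hA8 : 8 ≤ A / 2 := by rw [hA]; nlinarith
  have hAv : (8 : ℝ) ^ v ≤ (A / 2) ^ v := Real.rpow_le_rpow (by norm_num) hA8 hv0.le
  set τ := θ / A with hτ
  have hτ0 : 0 < τ := by positivity
  have hθv : 0 < θ ^ v := Real.rpow_pos_of_pos hθ0 v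
  have hpv : 0 < (2 * p) ^ v := Real.rpow_pos_of_pos (by positivity) v
  have hR : (A * p / θ) ^ v = (A / 2) ^ v * (2 * p) ^ v / θ ^ v := by
    rw [← Real.mul_rpow (by positivity) (by positivity),
      ← Real.div_rpow (by positivity) hθ0.le]
    congr 1; field_simp
  have hAv0 : 0 < (A / 2) ^ v := Real.rpow_pos_of_pos (by positivity) v
  have hexp : T * (8 * (A * p / θ) ^ v / 2) / (8 * (4 * (2 * p) ^ v) * L ^ 2) =
      2 * B ^ 2 * τ * (A / 2) ^ v := by
    have : θ = τ * (16 * B ^ 2 * L ^ 2) := by rw [← hA, hτ]; field_simp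
    rw [hR, hT]
    have e : θ * θ ^ v * (8 * ((A / 2) ^ v * (2 * p) ^ v / θ ^ v) / 2) /
        (8 * (4 * (2 * p) ^ v) * L ^ 2) = θ * (A / 2) ^ v / (8 * L ^ 2) := by
      field_simp
      norm_num
    rw [e]
    nth_rewrite 1 [this]
    field_simp
    norm_num
  have h8 := eight_le_eight_rpow hv
  have hgap : 8 * τ - 2 * B ^ 2 * τ * (A / 2) ^ v ≤ -(τ * 8 ^ v) := by
    have h1 : 2 * τ * 8 ^ v ≤ 2 * B ^ 2 * τ * (A / 2) ^ v := by
      calc 2 * τ * 8 ^ v = 2 * 1 * τ * 8 ^ v := by ring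
        _ ≤ 2 * B ^ 2 * τ * (A / 2) ^ v := by gcongr
    have h2 : 8 * τ ≤ τ * 8 ^ v := by nlinarith
    linarith
  have hlog : (2 * τ) ^ v ≤ Real.exp (τ * 8 ^ v) := by
    refine le_trans (Real.rpow_le_rpow (by positivity) ?_ hv0.le)
      (rpow_div_le_exp (by positivity) hv0)
    rw [le_div_iff₀ hv0]
    nlinarith [two_mul_le_eight_rpow hv]
  rw [hexp]
  calc 4 * (2 * p) ^ v * (n * Real.exp (-(2 * B ^ 2 * τ * (A / 2) ^ v)))
      ≤ 4 * (2 * p) ^ v * (Real.exp (8 * τ) * Real.exp (-(2 * B ^ 2 * τ * (A / 2) ^ v))) := by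
        gcongr
    _ ≤ 4 * (2 * p) ^ v * Real.exp (-(τ * 8 ^ v)) := by
        rw [← Real.exp_add]
        gcongr
        linarith
    _ ≤ 8 * (A * p / θ) ^ v / 2 := by
      rw [Real.exp_neg, ← div_eq_mul_inv, div_le_iff₀ (Real.exp_pos _)]
      have h7 := mul_le_mul_of_nonneg_left hlog (by positivity : 0 ≤ 8 * (A * p / θ) ^ v / 2)
      refine le_trans (le_of_eq ?_) h7
      have e : (2 * τ) ^ v = θ ^ v / (A / 2) ^ v := by
        rw [← Real.div_rpow hθ0.le (by positivity)]
        congr 1; rw [hτ]; field_simp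
      rw [hR, e]
      field_simp
      norm_num

end Rates

/-! ### Expected excess risk at a fixed critical radius. -/

section Risk

variable {Ω : Type*} [MeasurableSpace Ω] {P : Measure Ω} [IsProbabilityMeasure P] {dx dy : ℕ}
  {D : Set (Euc dx)} {F : Set (Euc dx → Euc dy)} {fstar : Euc dx → Euc dy}
  {X : ℕ → Ω → Euc dx} {W Y : ℕ → Ω → Euc dy} {T : ℕ} {fhat : Ω → Euc dx → Euc dy}

/-- Fewer than two centres means a single one, which `f` and `0` share; hence the factor 2. -/
theorem norm_le_of_entropyBound_lt_log_two {G : Set (Euc dx → Euc dy)} {p q : ℝ}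
    (hent : EntropyBound D G p q) (h0 : 0 ∈ G) {ε : ℝ} (hε0 : 0 < ε) (hε1 : ε < 1)
    (hlt : p * (1 / ε) ^ q < Real.log 2) : ∀ f ∈ G, ∀ x ∈ D, ‖f x‖ ≤ 2 * ε := by
  obtain ⟨N, ⟨-, hcov⟩, hfin, hcard⟩ := exists_isSupCover_of_entropyBound hent hε0 hε1
  have h2 : (N.ncard : ℝ) < 2 := hcard.trans_lt
    ((Real.exp_lt_exp.2 hlt).trans_eq (Real.exp_log (by norm_num)))
  have h1 : N.ncard ≤ 1 := by
    have : N.ncard < 2 := by exact_mod_cast h2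
    omega
  intro f hf x hx
  obtain ⟨g, hg, hfg⟩ := hcov f hf
  obtain ⟨g', hg', h0g⟩ := hcov 0 h0
  have : g' = g := (Set.ncard_le_one hfin).1 h1 _ hg' _ hg
  subst this
  have e1 := norm_le_of_supNorm_le hε0.le hfg hx
  have e2 := norm_le_of_supNorm_le hε0.le h0g hx
  simp only [Pi.sub_apply, Pi.zero_apply, zero_sub, norm_neg] at e1 e2
  calc ‖f x‖ = ‖(f x - g' x) + g' x‖ := by rw [sub_add_cancel]
    _ ≤ _ := (norm_add_le _ _).trans (by linarith)

theorem zero_mem_shiftedClass (hfstar : fstar ∈ F) : 0 ∈ shiftedClass F fstar :=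
  ⟨fstar, hfstar, (sub_self fstar).symm⟩

theorem excessRisk_ae_le (hXD : ∀ t ω, X t ω ∈ D) (hT : 1 ≤ T)
    (hfhat : IsLeastSquares P F X Y T fhat) {b : ℝ}
    (hbdd : ∀ f ∈ shiftedClass F fstar, ∀ x ∈ D, ‖f x‖ ≤ b) :
    ∀ᵐ ω ∂P, excessRisk P X T fstar fhat ω ≤ b ^ 2 := by
  filter_upwards [hfhat] with ω hω
  exact sqL2Norm_le hXD hT (hbdd _ ⟨_, hω.1, rfl⟩)

theorem integrable_excessRisk (hXD : ∀ t ω, X t ω ∈ D) (hT : 1 ≤ T)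
    (hfhat : IsLeastSquares P F X Y T fhat)
    (hrisk : AEStronglyMeasurable (excessRisk P X T fstar fhat) P) {b : ℝ}
    (hbdd : ∀ f ∈ shiftedClass F fstar, ∀ x ∈ D, ‖f x‖ ≤ b) :
    Integrable (excessRisk P X T fstar fhat) P := by
  refine Integrable.of_bound hrisk (b ^ 2) ?_
  filter_upwards [excessRisk_ae_le hXD hT hfhat hbdd] with ω hω
  have h0 : 0 ≤ excessRisk P X T fstar fhat ω := sqL2Norm_nonneg _ _ _ _
  rwa [Real.norm_of_nonneg h0]

theorem integral_excessRisk_le (hXD : ∀ t ω, X t ω ∈ D) (hT : 1 ≤ T)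
    (hfhat : IsLeastSquares P F X Y T fhat)
    (hrisk : AEStronglyMeasurable (excessRisk P X T fstar fhat) P) {b : ℝ}
    (hbdd : ∀ f ∈ shiftedClass F fstar, ∀ x ∈ D, ‖f x‖ ≤ b) :
    ∫ ω, excessRisk P X T fstar fhat ω ∂P ≤ b ^ 2 := by
  have := integral_mono_ae (integrable_excessRisk hXD hT hfhat hrisk hbdd)
    (integrable_const (b ^ 2)) (excessRisk_ae_le hXD hT hfhat hbdd)
  simpa using this

/-- The excess risk bound at a critical radius with square `ρ`, for a given finite cover. -/
theorem integral_excessRisk_le_of_cover (hF : ∀ f ∈ F, Measurable f) (hfstar : fstar ∈ F)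
    (hX : ∀ t, Measurable (X t)) (hXD : ∀ t ω, X t ω ∈ D)
    (hY : ∀ t ω, Y t ω = fstar (X t ω) + W t ω) (hT : 1 ≤ T)
    (hfhat : IsLeastSquares P F X Y T fhat)
    (hrisk : AEStronglyMeasurable (excessRisk P X T fstar fhat) P)
    (hM : Integrable (offsetComplexity X W T (shiftedClass F fstar)) P)
    (hstar : StarShaped (shiftedClass F fstar)) {b : ℝ} (hb : 0 < b)
    (hbdd : ∀ f ∈ shiftedClass F fstar, ∀ x ∈ D, ‖f x‖ ≤ b) {N : Set (Euc dx → Euc dy)}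
    (hN : N.Finite) {ε ρ : ℝ} (hε : 0 ≤ ε) (hcov : IsSupCover D (shiftedClass F fstar) N ε)
    (hρ : 0 < ρ) (hερ : 32 * ε ^ 2 ≤ ρ) (hL : 0 < matrixOpNorm (dependencyMatrix P X T)) :
    ∫ ω, excessRisk P X T fstar fhat ω ∂P ≤
      8 * ∫ ω, offsetComplexity X W T (shiftedClass F fstar) ω ∂P + ρ + b ^ 2 * (N.ncard *
        Real.exp (-(T * ρ / (8 * b ^ 2 * matrixOpNorm (dependencyMatrix P X T) ^ 2)))) := by
  have hGm : ∀ f ∈ shiftedClass F fstar, Measurable f := by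
    rintro _ ⟨f, hf, rfl⟩
    exact (hF f hf).sub (hF fstar hfstar)
  have h0 := zero_mem_shiftedClass hfstar
  obtain ⟨E, hEm, hE, hiso⟩ := exists_lower_isometry_event (P := P) hX hXD hT hGm hstar hb hbdd hN
    (fun f hf => by
      obtain ⟨g, hg, hfg⟩ := hcov.2 f hf
      exact ⟨g, hg, fun x hx => norm_le_of_supNorm_le hε hfg hx⟩) hρ hερ hL
  have hind : Integrable (E.indicator fun _ => b ^ 2) P := (integrable_const _).indicator hEm
  -- On `E` the uniform bound applies; off `E`, either the radius is subcritical or isometry and the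
  -- basic inequality combine.
  have key : ∀ᵐ ω ∂P, excessRisk P X T fstar fhat ω ≤
      8 * offsetComplexity X W T (shiftedClass F fstar) ω + ρ + E.indicator (fun _ => b ^ 2) ω := by
    filter_upwards [hfhat, excessRisk_ae_le hXD hT hfhat hbdd] with ω hω hle
    have hM0 := offsetComplexity_nonneg (W := W) (T := T) hXD hbdd h0 ω
    by_cases hωE : ω ∈ E
    · rw [Set.indicator_of_mem hωE]; linarith
    · rw [Set.indicator_of_notMem hωE, add_zero]
      have hmem : fhat ω - fstar ∈ shiftedClass F fstar := ⟨_, hω.1, rfl⟩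
      rcases le_total ρ (sqL2Norm P X T (fhat ω - fstar)) with h | h
      · have h1 := hiso ω hωE _ hmem h
        have h2 := empSqNorm_le_offsetProcess (W := W) hY (hω.2 fstar hfstar)
        have h3 := offsetProcess_le_offsetComplexity (W := W) (T := T) hXD hbdd hmem ω
        rw [excessRisk]
        linarith
      · rw [excessRisk]; linarith
  have h1 := integral_mono_ae (integrable_excessRisk hXD hT hfhat hrisk hbdd)
    (((hM.const_mul 8).add (integrable_const ρ)).add hind) key
  refine h1.trans ?_
  rw [integral_add' ((hM.const_mul 8).add (integrable_const ρ)) hind,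
    integral_add' (hM.const_mul 8) (integrable_const ρ), integral_const_mul, integral_indicator hEm,
    setIntegral_const, smul_eq_mul]
  simp only [integral_const, probReal_univ, one_smul]
  have := mul_le_mul_of_nonneg_left hE (sq_nonneg b)
  linarith

end Risk

end LittleMixing

end

/-! ### Choice of scales and conclusion. -/

open LittleMixing

theorem mainTheorem12 {Ω : Type*} [MeasurableSpace Ω] (P : Measure Ω) [IsProbabilityMeasure P]
    (𝓕 : Filtration ℕ (inferInstance : MeasurableSpace Ω)) {dx dy : ℕ}
    (D : Set (LittleMixing.Euc dx))
    (F : Set (LittleMixing.Euc dx → LittleMixing.Euc dy)) (hF : ∀ f ∈ F, Measurable f)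
    (fstar : LittleMixing.Euc dx → LittleMixing.Euc dy) (hfstar : fstar ∈ F)
    (X : ℕ → Ω → LittleMixing.Euc dx) (W Y : ℕ → Ω → LittleMixing.Euc dy)
    (hmodel : LittleMixing.IsRegressionModel P 𝓕 D fstar X W Y)
    (T : ℕ) (hT : 1 ≤ T)
    (fhat : Ω → LittleMixing.Euc dx → LittleMixing.Euc dy)
    (hfhat : LittleMixing.IsLeastSquares P F X Y T fhat)
    (hrisk : AEStronglyMeasurable (LittleMixing.excessRisk P X T fstar fhat) P)
    (B p q : ℝ) (hB : 1 ≤ B) (hp : 0 ≤ p) (hq0 : 0 < q) (hq2 : q < 2)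
    (hstar : LittleMixing.StarShaped (LittleMixing.shiftedClass F fstar))
    (hbdd : LittleMixing.IsBoundedClass D (LittleMixing.shiftedClass F fstar) B)
    (hent : LittleMixing.EntropyBound D (LittleMixing.shiftedClass F fstar) p q) :
    Integrable (LittleMixing.excessRisk P X T fstar fhat) P ∧
    Integrable (LittleMixing.offsetComplexity X W T (LittleMixing.shiftedClass F fstar)) P ∧
    ∫ ω, LittleMixing.excessRisk P X T fstar fhat ω ∂P ≤
      8 * ∫ ω, LittleMixing.offsetComplexity X W T (LittleMixing.shiftedClass F fstar) ω ∂P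
      + 8 * (16 * B ^ 2 * p *
            LittleMixing.matrixOpNorm (LittleMixing.dependencyMatrix P X T) ^ 2) ^ (2 / q)
          * (T : ℝ) ^ (-(2 / (2 + q)))
      + Real.exp (-((T : ℝ) ^ (q / (2 + q))) /
          (16 * B ^ 2 * LittleMixing.matrixOpNorm (LittleMixing.dependencyMatrix P X T) ^ 2)) := by
  have hX : ∀ t, Measurable (X t) := fun t => (hmodel.covariate_adapted t).mono (𝓕.le t) le_rfl
  have hW : ∀ t, Measurable (W t) := fun t =>
    (hmodel.noise_adapted t).mono (𝓕.le (t + 1)) le_rfl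
  have hXD := hmodel.mem_domain
  have hB0 : 0 < B := by linarith
  have hbddB : ∀ f ∈ shiftedClass F fstar, ∀ x ∈ D, ‖f x‖ ≤ B := fun f hf x hx =>
    norm_le_of_supNorm_le hB0.le (hbdd f hf) hx
  have h0 := zero_mem_shiftedClass hfstar
  have hGm : ∀ f ∈ shiftedClass F fstar, Measurable f := by
    rintro _ ⟨f, hf, rfl⟩
    exact (hF f hf).sub (hF fstar hfstar)
  have hMm : Measurable (offsetComplexity X W T (shiftedClass F fstar)) :=
    measurable_offsetComplexity hX hW hXD hGm h0 hbddB fun ε hε0 hε1 => by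
      obtain ⟨N, hN, hfin, -⟩ := exists_isSupCover_of_entropyBound hent hε0 hε1
      refine ⟨N, hN.1, hfin, fun f hf => ?_⟩
      obtain ⟨g, hg, hfg⟩ := hN.2 f hf
      exact ⟨g, hg, fun x hx => norm_le_of_supNorm_le hε0.le hfg hx⟩
  have hM : Integrable (offsetComplexity X W T (shiftedClass F fstar)) P :=
    integrable_offsetComplexity hMm (fun t => (hmodel.noise_memLp t).integrable one_le_two) hXD h0
      hbddB
  refine ⟨integrable_excessRisk hXD hT hfhat hrisk hbddB, hM, ?_⟩
  have hM0 : 0 ≤ ∫ ω, offsetComplexity X W T (shiftedClass F fstar) ω ∂P :=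
    integral_nonneg fun ω => offsetComplexity_nonneg hXD hbddB h0 ω
  have hL : 1 ≤ matrixOpNorm (dependencyMatrix P X T) :=
    one_le_matrixOpNorm_of_diag _ ⟨0, hT⟩ (by simp [dependencyMatrix])
  set L := matrixOpNorm (dependencyMatrix P X T) with hLdef
  have hL0 : 0 < L := by linarith
  have hT1 : (1 : ℝ) ≤ T := by exact_mod_cast hT
  have hT0 : (0 : ℝ) < T := by linarith
  set v := 2 / q with hv
  have hv1 : 1 ≤ v := by rw [hv, one_le_div hq0]; exact hq2.le
  have hv0 : 0 < v := by linarith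
  set A := 16 * B ^ 2 * L ^ 2 with hA
  have hA0 : 0 < A := by positivity
  set θ := (T : ℝ) ^ (q / (2 + q)) with hθ
  have hθ1 : 1 ≤ θ := Real.one_le_rpow hT1 (by positivity)
  have hθ0 : 0 < θ := by linarith
  have hθv : θ ^ v = (T : ℝ) ^ (2 / (2 + q)) := by
    rw [hθ, ← Real.rpow_mul hT0.le, hv]
    congr 1
    field_simp
  have hTθ : (T : ℝ) = θ * θ ^ v := by
    rw [hθv, hθ, ← Real.rpow_add hT0, ← add_div, add_comm q 2, div_self (by positivity),
      Real.rpow_one]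
  have hR : 8 * (16 * B ^ 2 * p * L ^ 2) ^ v * (T : ℝ) ^ (-(2 / (2 + q))) =
      8 * (A * p / θ) ^ v := by
    have e : 16 * B ^ 2 * p * L ^ 2 = A * p := by rw [hA]; ring
    rw [Real.rpow_neg hT0.le, ← hθv, Real.div_rpow (by positivity) hθ0.le, e, ← div_eq_mul_inv,
      mul_div_assoc]
  rw [hR]
  have hexp : 0 ≤ Real.exp (-θ / A) := (Real.exp_pos _).le
  -- The exponential term is nonnegative and may be discarded.
  suffices H : ∫ ω, excessRisk P X T fstar fhat ω ∂P ≤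
      8 * ∫ ω, offsetComplexity X W T (shiftedClass F fstar) ω ∂P + 8 * (A * p / θ) ^ v by
    linarith
  rcases hp.eq_or_lt with rfl | hp0
  -- For `p = 0` there is a one-point cover at every scale below 1, so the class vanishes on `D`.
  · have hzero : ∀ f ∈ shiftedClass F fstar, ∀ x ∈ D, ‖f x‖ ≤ 0 := fun f hf x hx => by
      refine le_of_forall_pos_le_add fun ε hε => ?_
      have hε1 : min (ε / 2) (1 / 2) < 1 := (min_le_right _ _).trans_lt (by norm_num)
      have := norm_le_of_entropyBound_lt_log_two hent h0 (ε := min (ε / 2) (1 / 2))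
        (by positivity) hε1 (by rw [zero_mul]; exact Real.log_pos (by norm_num)) f hf x hx
      linarith [min_le_left (ε / 2) (1 / 2)]
    have h1 := integral_excessRisk_le hXD hT hfhat hrisk hzero
    have h2 : 0 ≤ (A * 0 / θ) ^ v := Real.rpow_nonneg (by simp) v
    norm_num at h1
    linarith
  set R := 8 * (A * p / θ) ^ v with hRdef
  have hR0 : 0 < R := by positivity
  have hs2 : Real.sqrt R ^ 2 = R := Real.sq_sqrt hR0.le
  have hs0 : 0 < Real.sqrt R := Real.sqrt_pos.2 hR0
  have hcover : R < 64 → ∃ N : Set (Euc dx → Euc dy),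
      IsSupCover D (shiftedClass F fstar) N (Real.sqrt R / 8) ∧ N.Finite ∧
        (N.ncard : ℝ) ≤ Real.exp (8 * (θ / A)) := fun h => by
    have hs8 : Real.sqrt R < 8 := by
      rw [Real.sqrt_lt' (by norm_num)]; linarith
    obtain ⟨N, hN, hfin, hcard⟩ := exists_isSupCover_of_entropyBound hent
      (ε := Real.sqrt R / 8) (by positivity) (by linarith)
    exact ⟨N, hN, hfin, hcard.trans (Real.exp_le_exp.2
      (mul_one_div_sqrt_rpow_le hp0 hq0 hq2 hA0 hθ0))⟩
  -- The critical squared radius is `R / 2`, and `√R / 8` is the largest scale that `32 ε² ≤ R / 2`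
  -- allows. It is below 1 exactly when `R < 64`.
  have hscale : 32 * (Real.sqrt R / 8) ^ 2 ≤ R / 2 := by rw [div_pow, hs2]; linarith
  rcases le_or_gt (1 / 2) p with hp2 | hp2
  · obtain ⟨ε, e, N, hε, hcov, hfin, hερ, hcard, he⟩ : ∃ (ε e : ℝ) (N : Set (Euc dx → Euc dy)),
        0 ≤ ε ∧ IsSupCover D (shiftedClass F fstar) N ε ∧ N.Finite ∧ 32 * ε ^ 2 ≤ R / 2 ∧
          (N.ncard : ℝ) ≤ Real.exp e ∧ (e ≤ 8 * (θ / A) ∨ e ≤ 4 * p) := by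
      rcases lt_or_ge R 64 with h | h
      · obtain ⟨N, hN, hfin, hcard⟩ := hcover h
        exact ⟨_, _, N, by positivity, hN, hfin, hscale, hcard, Or.inl le_rfl⟩
      -- For `R ≥ 64` the fixed scale `1 / 2` suffices, with entropy at most `4 * p` because `q <
      -- 2`.
      · obtain ⟨N, hN, hfin, hcard⟩ := exists_isSupCover_of_entropyBound hent
          (ε := 1 / 2) (by norm_num) (by norm_num)
        refine ⟨_, _, N, by norm_num, hN, hfin, by linarith, hcard, Or.inr ?_⟩
        have : (1 / (1 / 2) : ℝ) ^ q ≤ 4 := by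
          calc (1 / (1 / 2) : ℝ) ^ q ≤ (1 / (1 / 2)) ^ (2 : ℝ) :=
                Real.rpow_le_rpow_of_exponent_le (by norm_num) hq2.le
            _ = 4 := by norm_num
        nlinarith
    have h1 := integral_excessRisk_le_of_cover hF hfstar hX hXD hmodel.observation hT hfhat hrisk
      hM hstar hB0 hbddB hfin hε hcov (half_pos hR0) hερ (hLdef ▸ hL0)
    have h2 := mul_exp_le_half_of_large hB hL hp2 hv1 hA hθ1 hTθ hcard he
    rw [← hRdef] at h2
    linarith
  -- At scale `(2p)^(1/q) < 1` the entropy bound is `1/2 < log 2`, so the whole class has norm at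
  -- most twice that scale, which is `b`.
  · set b := Real.sqrt (4 * (2 * p) ^ v) with hb
    have hb2 : b ^ 2 = 4 * (2 * p) ^ v := Real.sq_sqrt (by positivity)
    have hb0 : 0 < b := Real.sqrt_pos.2 (by positivity)
    have hbddb : ∀ f ∈ shiftedClass F fstar, ∀ x ∈ D, ‖f x‖ ≤ b := by
      have hε1 : (2 * p) ^ (1 / q) < 1 :=
        Real.rpow_lt_one (by positivity) (by linarith) (by positivity)
      have hlog : p * (1 / (2 * p) ^ (1 / q)) ^ q < Real.log 2 := by
        rw [Real.div_rpow zero_le_one (by positivity), Real.one_rpow,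
          ← Real.rpow_mul (by positivity), one_div_mul_cancel hq0.ne', Real.rpow_one]
        have : p * (1 / (2 * p)) = 1 / 2 := by field_simp
        rw [this]
        linarith [Real.log_two_gt_d9]
      have hbe : 2 * (2 * p) ^ (1 / q) = b := by
        rw [hb, Real.sqrt_mul (by norm_num), Real.sqrt_eq_rpow ((2 * p) ^ v),
          ← Real.rpow_mul (by positivity), show (4 : ℝ) = 2 ^ 2 by norm_num,
          Real.sqrt_sq (by norm_num), hv]
        congr 2
        field_simp
      rw [← hbe]
      exact norm_le_of_entropyBound_lt_log_two hent h0 (by positivity) hε1 hlog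
    -- If `b² ≤ R` the uniform bound already suffices. Otherwise `R < b² ≤ 4`, so the scale `√R / 8`
    -- is admissible.
    rcases le_or_gt (b ^ 2) R with hbR | hbR
    · linarith [integral_excessRisk_le hXD hT hfhat hrisk hbddb]
    · have hb4 : b ^ 2 ≤ 4 := by
        rw [hb2]
        linarith [Real.rpow_le_one (by positivity : 0 ≤ 2 * p) (by linarith) hv0.le]
      obtain ⟨N, hcov, hfin, hcard⟩ := hcover (by linarith)
      have h1 := integral_excessRisk_le_of_cover hF hfstar hX hXD hmodel.observation hT hfhat hrisk
        hM hstar hb0 hbddb hfin (by positivity) hcov (half_pos hR0) hscale (hLdef ▸ hL0)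
      have h2 := mul_exp_le_half_of_small hB hL hp0 hv1 hA hθ1 hTθ hcard
      rw [← hRdef, ← hb2] at h2
      linarith
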